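/- Notation. For real $q$ with $q\neq0$, $|q|\ne1$ put $(q;q)_k=\prod_{i=1}^k(1-q^i)$, and for natural numbers $k$ $$\Gamma_q(k+1)=\frac{(q;q)_k}{(1-q)^k},\qquad G_q(k+1)=\prod_{i=1}^{k-1}\Gamma_q(i+1),\qquad G(k+1)=\prod_{i=1}^{k-1}\Gamma(i+1)$$ (the $q$-Gamma, $q$-Barnes and Barnes functions at positive integers). For $n\in\mathbb Z$, $m\in\mathbb N$ let ${n\brack m}_q=\prod_{i=1}^m\frac{1-q^{n-m+i}}{1-q^i}$, so that ${n\brack m}_q=\frac{\Gamma_q(n+1)}{\Gamma_q(m+1)\Gamma_q(n-m+1)}$ if $n\ge m$, and let $\binom nm=\prod_{i=1}^m\frac{n-m+i}{i}$. $s_{\mu/\lambda}=\det\left(h_{\mu_a-\lambda_b-a+b}\right)_{a,b}$ is the skew Schur polynomial, and $(N^d,j)$ is the partition with $d$ parts $N$ followed by a part $j$. (1) Let $d\ge1$, $0\le j,k\le N$, and $M>d$ (or $M\ge d$, if $j=0$). For every real $q$ with $q\ne0$, $|q|\neq1$, $$s_{(N^d,j)/(k)}(1,q,\dots,q^{M-1})=q^{(d-1)j-dk+d(d-1)N/2}\,G_q(N+2)\frac{G_q(M+N+2)}{G_q(M+1)}\frac{G_q(M-d+1)}{G_q(M-d+N+2)}\frac{G_q(d+1)}{G_q(d+N+2)}$$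 $$\times\sum_{r=\max(j,k)}^{N}q^{r}\,\frac{\Gamma_q(M-d+j+1)\Gamma_q(d+k+1)\Gamma_q(r+1)}{\Gamma_q(j+1)\Gamma_q(k+1)\Gamma_q(M+r+1)}{M-d+r-k-1\brack r-k}_q{d+r-j-1\brack r-j}_q .$$ (2) For the same $N,d,j,k,M$, as $q\to1$ ($q\neq 1$) the right-hand side of (1) converges to $$G(N+2)\frac{G(M+N+2)}{G(M+1)}\frac{G(M-d+1)}{G(M-d+N+2)}\frac{G(d+1)}{G(d+N+2)}\frac{\Gamma(M-d+j+1)}{\Gamma(j+1)}\frac{\Gamma(d+k+1)}{\Gamma(k+1)}\sum_{r=\max(j,k)}^{N}\frac{\Gamma(r+1)}{\Gamma(M+r+1)}\binom{M-d+r-k-1}{r-k}\binom{d+r-j-1}{r-j},$$ and this number equals $s_{(N^d,j)/(k)}(1^M)$. (3) Let $q$ be real with $q\ne0$, $|q|\ne1$, let $\gamma,\delta\ge1$ be integers, and let $\Theta_{\gamma,\delta}(z)=\prod_{i=0}^{\delta-1}(1+q^iz^{-1})\prod_{i=1}^{\gamma}(1+q^iz)$ for $z\neq0$. Let $T_N=(d_{a-b})_{a,b=1}^N$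 be its Toeplitz matrix, where $d_m=\frac1{2\pi}\int_0^{2\pi}\Theta_{\gamma,\delta}(e^{i\theta})e^{-im\theta}d\theta$. Then: (a) $\Theta_{\gamma,\delta}(z)=\sum_{m=-\delta}^{\gamma}{\delta+\gamma\brack\delta+m}_q\,q^{m(m+1)/2}z^m$. (b) For all $N\geq 0$, $\det T_N=G_q(N+1)\frac{G_q(\delta+\gamma+N+1)}{G_q(\delta+\gamma+1)}\frac{G_q(\delta+1)}{G_q(\delta+N+1)}\frac{G_q(\gamma+1)}{G_q(\gamma+N+1)}$. (c) For $n\ge0$ let $c_n=\left(\frac{(q;q)_{\delta+n}(q;q)_{\gamma+n}}{(q;q)_n(q;q)_{\delta+\gamma+n}}\right)^{1/2}$ (principal square root) and $$p_n(z)=c_n\sum_{r=0}^n(-1)^{n+r}{n\brack r}_q\frac{(q;q)_{\gamma+r}}{(q;q)_{\gamma+n}}\frac{(q;q)_{\delta+n-r-1}}{(q;q)_{\delta-1}}z^r,$$ $$q_n(z)=c_n\sum_{r=0}^n(-1)^{n+r}{n\brack r}_q\frac{(q;q)_{\gamma+n-r-1}}{(q;q)_{\gamma-1}}\frac{(q;q)_{\delta+r}}{(q;q)_{\delta+n}}q^{n-r}z^r.$$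 Then $p_n,q_n$ have degree $n$, and $\frac1{2\pi}\int_0^{2\pi}p_m(e^{i\theta})q_n(e^{-i\theta})\Theta_{\gamma,\delta}(e^{i\theta})\,d\theta=\delta_{m,n}$ (Kronecker delta) for all $m,n\ge0$. (d) For all $N\ge0$, $T_{N+1}$ is invertible, and for $0\le j,k\le N$ $$(T_{N+1}^{-1})_{j+1,k+1}=\sum_{r=\max(j,k)}^N(-1)^{j+k}q^{r-k}\frac{\Gamma_q(\gamma+j+1)\Gamma_q(\delta+k+1)\Gamma_q(r+1)}{\Gamma_q(j+1)\Gamma_q(k+1)\Gamma_q(\delta+\gamma+r+1)}{\gamma+r-k-1\brack r-k}_q{\delta+r-j-1\brack r-j}_q .$$ -/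

import Mathlib

open scoped BigOperators Topology

noncomputable section

/-- The finite `q`-Pochhammer product `(q;q)_k = ∏_{i=1}^{k} (1 - q^i)`. -/
def qPoch (q : ℝ) (k : ℕ) : ℝ := ∏ i ∈ Finset.Icc 1 k, (1 - q ^ i)

/-- The `q`-Gamma function at natural arguments: `Γ_q(k+1) = (q;q)_k / (1-q)^k`.
The argument `0` is a pole, where the value is irrelevant (set to `0`). -/
def qGamma (q : ℝ) : ℕ → ℝ
  | 0 => 0
  | k + 1 => qPoch q k / (1 - q) ^ k

/-- The `q`-Barnes function at natural arguments: `G_q(k+1) = ∏_{i=1}^{k-1} Γ_q(i+1)`, `G_q(0) = 0`. -/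
def qBarnes (q : ℝ) : ℕ → ℝ
  | 0 => 0
  | k + 1 => ∏ i ∈ Finset.Icc 1 (k - 1), qGamma q (i + 1)

/-- The `q`-binomial coefficient `[n, m]_q = ∏_{i=1}^{m} (1 - q^{n-m+i}) / (1 - q^i)`
for an integer `n` and a natural number `m`; thus `[-1, 0]_q = 1` and `[m-1, m]_q = 0` for `m ≥ 1`. -/
def qBinom (q : ℝ) (n : ℤ) (m : ℕ) : ℝ :=
  ∏ i ∈ Finset.Icc 1 m, (1 - q ^ (n - (m : ℤ) + (i : ℤ))) / (1 - q ^ i)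

theorem qPoch_ne_zero {q : ℝ} (hq : |q| ≠ 1) (k : ℕ) : qPoch q k ≠ 0 := by
  refine Finset.prod_ne_zero_iff.2 fun i hi => ?_
  have hi1 : i ≠ 0 := by have := (Finset.mem_Icc.1 hi).1; omega
  intro h
  apply hq
  have h1 : q ^ i = 1 := by linarith
  have h2 : |q| ^ i = 1 := by rw [← abs_pow, h1, abs_one]
  exact (pow_eq_one_iff_of_nonneg (abs_nonneg q) hi1).1 h2

/-- On natural numbers `m ≤ n` the `q`-binomial coefficient is the usual quotient of `q`-Gamma
values. -/
theorem qBinom_eq_qGamma {q : ℝ} (hq : |q| ≠ 1) {n m : ℕ} (h : m ≤ n) :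
    qBinom q n m = qGamma q (n + 1) / (qGamma q (m + 1) * qGamma q (n - m + 1)) := by
  obtain ⟨l, rfl⟩ := Nat.exists_eq_add_of_le h
  have hq1 : (1 - q) ≠ 0 := by
    intro h0
    apply hq
    have : q = 1 := by linarith
    simp [this]
  have key : ∀ m : ℕ, qPoch q (m + l) =
      qPoch q l * ∏ i ∈ Finset.Icc 1 m, (1 - q ^ (l + i)) := by
    intro m
    induction m with
    | zero => simp
    | succ m ih =>
      have e1 : qPoch q (m + 1 + l) = qPoch q (m + l) * (1 - q ^ (m + l + 1)) := by
        have : m + 1 + l = (m + l) + 1 := by ring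
        rw [this]
        exact Finset.prod_Icc_succ_top (by omega) _
      rw [e1, ih, Finset.prod_Icc_succ_top (by omega)]
      have : m + l + 1 = l + (m + 1) := by ring
      rw [this]
      ring
  have hnum : qBinom q ((m + l : ℕ) : ℤ) m =
      (∏ i ∈ Finset.Icc 1 m, (1 - q ^ (l + i))) / qPoch q m := by
    unfold qBinom qPoch
    rw [Finset.prod_div_distrib]
    congr 1
    refine Finset.prod_congr rfl fun i _ => ?_
    have : ((m + l : ℕ) : ℤ) - (m : ℤ) + (i : ℤ) = ((l + i : ℕ) : ℤ) := by push_cast; ring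
    rw [this, zpow_natCast]
  have hl := qPoch_ne_zero hq l
  have hm := qPoch_ne_zero hq m
  rw [hnum, Nat.add_sub_cancel_left]
  simp only [qGamma]
  rw [key m]
  field_simp
  ring

/-- The classical Barnes function at natural arguments: `G(k+1) = ∏_{i=1}^{k-1} Γ(i+1)`, `G(0) = 0`. -/
def barnesG : ℕ → ℝ
  | 0 => 0
  | k + 1 => ∏ i ∈ Finset.Icc 1 (k - 1), Real.Gamma ((i : ℝ) + 1)

/-- The complete homogeneous symmetric polynomial `h_m` for an integer index; it vanishes for `m < 0`. -/
def hsymmInt (n : ℕ) (m : ℤ) : MvPolynomial (Fin n) ℝ :=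
  if 0 ≤ m then MvPolynomial.hsymm (Fin n) ℝ m.toNat else 0

/-- The skew Schur polynomial `s_{μ/ν}(x_1, …, x_n) = det (h_{μ_a - ν_b - a + b})`. A partition is
the non-increasing list of its parts; entries beyond the end of the list are zero, and trailing
zeros are allowed (they do not change the determinant). -/
def skewSchur (n : ℕ) (μ ν : List ℕ) : MvPolynomial (Fin n) ℝ :=
  Matrix.det (Matrix.of fun a b : Fin (max μ.length ν.length) =>
    hsymmInt n ((μ.getD a 0 : ℤ) - (ν.getD b 0 : ℤ) - (a : ℤ) + (b : ℤ)))

/-- `s_{(N^d, j)/(k)}(1, q, …, q^{M-1})`. -/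
def skewSpec (q : ℝ) (N d j k M : ℕ) : ℝ :=
  MvPolynomial.eval (fun i : Fin M => q ^ (i : ℕ))
    (skewSchur M (List.replicate d N ++ [j]) [k])

/-- The explicit value of `s_{(N^d, j)/(k)}(1, q, …, q^{M-1})`. -/
def qFormula (q : ℝ) (N d j k M : ℕ) : ℝ :=
  q ^ (((d : ℤ) - 1) * j - d * k + (d : ℤ) * ((d : ℤ) - 1) * N / 2)
    * (qBarnes q (N + 2)
      * (qBarnes q (M + N + 2) / qBarnes q (M + 1))
      * (qBarnes q (M - d + 1) / qBarnes q (M - d + N + 2))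
      * (qBarnes q (d + 1) / qBarnes q (d + N + 2)))
    * ∑ r ∈ Finset.Icc (max j k) N,
        q ^ r
        * ((qGamma q (M - d + j + 1) * qGamma q (d + k + 1) * qGamma q (r + 1))
          / (qGamma q (j + 1) * qGamma q (k + 1) * qGamma q (M + r + 1)))
        * qBinom q ((M : ℤ) - d + r - k - 1) (r - k)
        * qBinom q ((d : ℤ) + r - j - 1) (r - j)

/-- The explicit value of `s_{(N^d, j)/(k)}(1^M)`. -/
def classicalFormula (N d j k M : ℕ) : ℝ :=
  (barnesG (N + 2)
      * (barnesG (M + N + 2) / barnesG (M + 1))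
      * (barnesG (M - d + 1) / barnesG (M - d + N + 2))
      * (barnesG (d + 1) / barnesG (d + N + 2)))
    * (Real.Gamma ((M : ℝ) - d + j + 1) / Real.Gamma ((j : ℝ) + 1))
    * (Real.Gamma ((d : ℝ) + k + 1) / Real.Gamma ((k : ℝ) + 1))
    * ∑ r ∈ Finset.Icc (max j k) N,
        (Real.Gamma ((r : ℝ) + 1) / Real.Gamma ((M : ℝ) + r + 1))
        * (Ring.choose ((M : ℤ) - d + r - k - 1) (r - k) : ℝ)
        * (Ring.choose ((d : ℤ) + r - j - 1) (r - j) : ℝ)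

/-- The symbol `Θ_{γ,δ}(z) = ∏_{i=0}^{δ-1} (1 + q^i z⁻¹) ∏_{i=1}^{γ} (1 + q^i z)`. -/
def thetaSymbol (q : ℝ) (γ δ : ℕ) (z : ℂ) : ℂ :=
  (∏ i ∈ Finset.range δ, (1 + (q : ℂ) ^ i * z⁻¹)) *
    ∏ i ∈ Finset.Icc 1 γ, (1 + (q : ℂ) ^ i * z)

/-- The average over the unit circle, `(2π)⁻¹ ∫_0^{2π} f(e^{iθ}) dθ`. -/
def circleMean (f : ℂ → ℂ) : ℂ :=
  (2 * (Real.pi : ℂ))⁻¹ * ∫ θ in (0 : ℝ)..(2 * Real.pi), f (Complex.exp (Complex.I * θ))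

/-- The Toeplitz matrix `T_N(f) = (d_{a-b})`, with `d_m` the `m`-th Fourier coefficient of `f`. -/
def toeplitz (f : ℂ → ℂ) (N : ℕ) : Matrix (Fin N) (Fin N) ℂ :=
  Matrix.of fun a b => circleMean fun z => f z * z ^ (-((a : ℤ) - (b : ℤ)))

/-- The normalisation
`((q;q)_{δ+n} (q;q)_{γ+n} / ((q;q)_n (q;q)_{δ+γ+n}))^{1/2}` (principal square root). -/
def biorthNorm (q : ℝ) (γ δ n : ℕ) : ℂ :=
  (((qPoch q (δ + n) * qPoch q (γ + n)) / (qPoch q n * qPoch q (δ + γ + n)) : ℝ) : ℂ)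
    ^ (1 / 2 : ℂ)

/-- The biorthogonal polynomial `p_n` of `Θ_{γ,δ}`. -/
def biorthP (q : ℝ) (γ δ n : ℕ) : Polynomial ℂ :=
  ∑ r ∈ Finset.range (n + 1), Polynomial.monomial r
    (biorthNorm q γ δ n * (((-1) ^ (n + r) * qBinom q n r
      * (qPoch q (γ + r) / qPoch q (γ + n))
      * (qPoch q (δ + n - r - 1) / qPoch q (δ - 1)) : ℝ) : ℂ))

/-- The biorthogonal polynomial `q_n` of `Θ_{γ,δ}`. -/
def biorthQ (q : ℝ) (γ δ n : ℕ) : Polynomial ℂ :=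
  ∑ r ∈ Finset.range (n + 1), Polynomial.monomial r
    (biorthNorm q γ δ n * (((-1) ^ (n + r) * qBinom q n r
      * (qPoch q (γ + n - r - 1) / qPoch q (γ - 1))
      * (qPoch q (δ + r) / qPoch q (δ + n)) * q ^ (n - r) : ℝ) : ℂ))

end

/-! Part (3) rests on one computation. As a functional on functions of y = q^{-r}, the n-fold
q-difference `qDiff` kills polynomials of degree less than n (a case of the q-binomial theorem) and
has a closed value on 1/(1 - a y). Let d_m be the Laurent coefficients of the symbol. For δ ≥ 1, the
r-th coefficient of p_n times d_{s-r} is, up to a constant, the weight of `qDiff` times a function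
of y: for s < n a polynomial of degree at most n - 1, for s = n a polynomial of degree at most n
divided by a single factor 1 - a y. So p_n is orthogonal to the lower powers and its norm is
explicit (`sum_pCoeff_mul_thetaCoeff_eq_zero`, `sum_pCoeff_mul_thetaCoeff_self`). The symmetry
Θ_{γ,δ}(z) = Θ_{δ,γ}(1/(qz)) transfers orthogonality to q_n.

In matrix form Q T Pᵀ = D, with P and Q unit lower triangular and D diagonal. Hence det T is the
product of the norms, which telescopes to Barnes functions, and T⁻¹ = Pᵀ D⁻¹ Q, whose entries are
the sums over r.

For part (1), the series ∏ (1 - q^i X) and ∑ h_n X^n are inverse, so their lower triangular Toeplitz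
matrices are too. By Jacobi's complementary minor argument the Jacobi-Trudi determinant of (N^d,
j)/(k) equals, up to sign, det T' · (T'⁻¹)_{jk}, where T' = (e_{d+a-b}) is built from the
coefficients of the first series (`ConvInv.det_skew`). By the q-binomial theorem T' is a scalar
multiple of a diagonal conjugate of the Toeplitz matrix of Θ_{M-d,d}, so part (3) evaluates it. Part
(2) is a termwise limit, compared with the continuity in q of the specialized polynomial. -/

noncomputable section

/-! ### Reciprocal Pochhammer symbols and Gaussian binomials. -/

/-- The reciprocal `1 / (q;q)_m`, extended by zero to negative integers. -/
def qPochInv (q : ℝ) (m : ℤ) : ℝ := if 0 ≤ m then (qPoch q m.toNat)⁻¹ else 0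

theorem qPochInv_natCast (q : ℝ) (n : ℕ) : qPochInv q n = (qPoch q n)⁻¹ := by
  simp [qPochInv]

theorem qPochInv_of_neg (q : ℝ) {m : ℤ} (h : m < 0) : qPochInv q m = 0 := by
  simp [qPochInv, not_le.2 h]

theorem qPoch_zero (q : ℝ) : qPoch q 0 = 1 := by simp [qPoch]

theorem qPoch_succ (q : ℝ) (n : ℕ) : qPoch q (n + 1) = qPoch q n * (1 - q ^ (n + 1)) :=
  Finset.prod_Icc_succ_top (by omega) _

theorem one_sub_pow_ne_zero {q : ℝ} (hq : |q| ≠ 1) {n : ℕ} (hn : n ≠ 0) : 1 - q ^ n ≠ 0 := by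
  obtain ⟨n, rfl⟩ := Nat.exists_eq_succ_of_ne_zero hn
  have h := qPoch_ne_zero hq (n + 1)
  rw [qPoch_succ] at h
  exact right_ne_zero_of_mul h

/-- At m = 0 both sides vanish because 1 - q^0 = 0, so the extension by zero obeys the recurrence on
all integers. -/
theorem qPochInv_sub_one {q : ℝ} (hq : |q| ≠ 1) (m : ℤ) :
    qPochInv q (m - 1) = qPochInv q m * (1 - q ^ m) := by
  rcases lt_trichotomy m 0 with h | rfl | h
  · rw [qPochInv_of_neg q h, qPochInv_of_neg q (by omega), zero_mul]
  · simp [qPochInv]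
  · obtain ⟨n, rfl⟩ : ∃ n : ℕ, m = n + 1 := ⟨(m - 1).toNat, by omega⟩
    have h1 := qPochInv_natCast q (n + 1)
    push_cast at h1
    have h2 : q ^ ((n : ℤ) + 1) = q ^ (n + 1) := by exact_mod_cast zpow_natCast q (n + 1)
    rw [add_sub_cancel_right, h1, qPochInv_natCast, qPoch_succ, h2]
    have := qPoch_ne_zero hq n
    have := one_sub_pow_ne_zero hq (Nat.succ_ne_zero n)
    rw [Nat.succ_eq_add_one] at this
    field_simp

/-- Iterates the recurrence. No condition s ≤ n is needed: for s > n the factor i = n is zero. -/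
theorem qPoch_mul_qPochInv_sub {q : ℝ} (hq : |q| ≠ 1) (n s : ℕ) :
    qPoch q n * qPochInv q ((n : ℤ) - s) = ∏ i ∈ Finset.range s, (1 - q ^ ((n : ℤ) - i)) := by
  induction s with
  | zero => simp [qPochInv_natCast, qPoch_ne_zero hq n]
  | succ s ih =>
    rw [Finset.prod_range_succ, ← ih, Nat.cast_succ, ← sub_sub, qPochInv_sub_one hq, mul_assoc]

/-- The `q`-binomial coefficient with natural upper index, zero for `r > n`. -/
def gauss (q : ℝ) (n r : ℕ) : ℝ := qPoch q n * qPochInv q r * qPochInv q ((n : ℤ) - r)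

theorem gauss_of_lt (q : ℝ) {n r : ℕ} (h : n < r) : gauss q n r = 0 := by
  rw [gauss, qPochInv_of_neg q (m := (n : ℤ) - r) (by omega), mul_zero]

theorem gauss_zero_right {q : ℝ} (hq : |q| ≠ 1) (n : ℕ) : gauss q n 0 = 1 := by
  have := qPoch_ne_zero hq n
  rw [gauss, Nat.cast_zero, sub_zero, qPochInv_natCast]
  simp [qPochInv, qPoch_zero, this]

theorem gauss_self {q : ℝ} (hq : |q| ≠ 1) (n : ℕ) : gauss q n n = 1 := by
  have := qPoch_ne_zero hq n
  rw [gauss, sub_self, qPochInv_natCast]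
  simp [qPochInv, qPoch_zero, this]

/-- Pascal's rule, multiplied by q^r so that q^{n-r} does not appear and r > n is allowed. -/
theorem gauss_succ_succ {q : ℝ} (hq : |q| ≠ 1) (n r : ℕ) :
    q ^ r * gauss q (n + 1) (r + 1) = q ^ r * gauss q n (r + 1) + q ^ n * gauss q n r := by
  rcases lt_or_ge n r with h | h
  · rw [gauss_of_lt q h, gauss_of_lt q (by omega), gauss_of_lt q (by omega)]; ring
  obtain ⟨l, rfl⟩ := Nat.exists_eq_add_of_le h
  have e1 : (((r + l + 1 : ℕ) : ℤ) - ((r + 1 : ℕ) : ℤ)) = l := by push_cast; ring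
  have e2 : (((r + l : ℕ) : ℤ) - ((r + 1 : ℕ) : ℤ)) = (l : ℤ) - 1 := by push_cast; ring
  have e3 : (((r + l : ℕ) : ℤ) - (r : ℤ)) = l := by push_cast; ring
  rw [gauss, gauss, gauss, e1, e2, e3, qPochInv_sub_one hq, qPochInv_natCast, qPochInv_natCast,
    qPochInv_natCast, qPoch_succ, qPoch_succ q r, zpow_natCast]
  have h1 := qPoch_ne_zero hq r
  have h2 := qPoch_ne_zero hq l
  have h3 := one_sub_pow_ne_zero hq (Nat.succ_ne_zero r)
  rw [Nat.succ_eq_add_one] at h3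
  field_simp
  ring

/-! ### The q-difference functional. -/

/-- The `n`-fold `q`-difference `∑ (-1)^r [n, r]_q q^{r(r-1)/2} f(r)`. -/
def qDiff (q : ℝ) (n : ℕ) (f : ℕ → ℝ) : ℝ :=
  ∑ r ∈ Finset.range (n + 1), (-1) ^ r * gauss q n r * q ^ (r.choose 2) * f r

/-- Pascal's rule. With the shift E it says that `qDiff q n` is ∏_{i<n} (1 - q^i E) evaluated at 0.
-/
theorem qDiff_succ {q : ℝ} (hq : |q| ≠ 1) (n : ℕ) (f : ℕ → ℝ) :
    qDiff q (n + 1) f = qDiff q n f - q ^ n * qDiff q n (fun r => f (r + 1)) := by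
  have h1 : qDiff q n f = ∑ r ∈ Finset.range (n + 2),
      (-1) ^ r * gauss q n r * q ^ (r.choose 2) * f r := by
    rw [Finset.sum_range_succ, gauss_of_lt q (Nat.lt_succ_self n), qDiff]; simp
  rw [h1, qDiff, qDiff, Finset.sum_range_succ', Finset.sum_range_succ' _ (n + 1), Finset.mul_sum,
    gauss_zero_right hq, gauss_zero_right hq, add_sub_right_comm, ← Finset.sum_sub_distrib]
  congr 1
  refine Finset.sum_congr rfl fun r _ => ?_
  have e : (r + 1).choose 2 = r.choose 2 + r := by
    rw [Nat.choose_succ_succ' r 1, Nat.choose_one_right, add_comm]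
  rw [e]
  have := gauss_succ_succ hq n r
  linear_combination (-1) ^ (r + 1) * q ^ r.choose 2 * f (r + 1) * this

theorem qDiff_congr {q : ℝ} {n : ℕ} {f g : ℕ → ℝ} (h : ∀ r ≤ n, f r = g r) :
    qDiff q n f = qDiff q n g := by
  refine Finset.sum_congr rfl fun r hr => ?_
  rw [h r (Nat.lt_succ_iff.1 (Finset.mem_range.1 hr))]

theorem qDiff_const_mul (q : ℝ) (n : ℕ) (c : ℝ) (f : ℕ → ℝ) :
    qDiff q n (fun r => c * f r) = c * qDiff q n f := by
  rw [qDiff, qDiff, Finset.mul_sum]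
  exact Finset.sum_congr rfl fun r _ => by ring

theorem qDiff_sub (q : ℝ) (n : ℕ) (f g : ℕ → ℝ) :
    qDiff q n (fun r => f r - g r) = qDiff q n f - qDiff q n g := by
  rw [qDiff, qDiff, qDiff, ← Finset.sum_sub_distrib]
  exact Finset.sum_congr rfl fun r _ => by ring

theorem qDiff_sum (q : ℝ) (n : ℕ) {ι : Type*} (s : Finset ι) (f : ι → ℕ → ℝ) :
    qDiff q n (fun r => ∑ i ∈ s, f i r) = ∑ i ∈ s, qDiff q n (f i) := by
  simp only [qDiff]
  rw [Finset.sum_comm]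
  exact Finset.sum_congr rfl fun r _ => by rw [Finset.mul_sum]

/-- The `q`-binomial theorem. -/
theorem qDiff_pow {q : ℝ} (hq : |q| ≠ 1) (n : ℕ) (x : ℝ) :
    qDiff q n (fun r => x ^ r) = ∏ i ∈ Finset.range n, (1 - q ^ i * x) := by
  induction n with
  | zero => simp [qDiff, gauss_self hq]
  | succ n ih =>
    have : (fun r : ℕ => x ^ (r + 1)) = fun r => x * x ^ r := by funext r; ring
    rw [qDiff_succ hq, this, qDiff_const_mul, ih, Finset.prod_range_succ]
    ring

theorem qDiff_inv_pow_eq_zero {q : ℝ} (hq0 : q ≠ 0) (hq : |q| ≠ 1) {m n : ℕ} (h : m < n) :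
    qDiff q n (fun r => (q⁻¹ ^ r) ^ m) = 0 := by
  have : (fun r : ℕ => (q⁻¹ ^ r) ^ m) = fun r => (q⁻¹ ^ m) ^ r := by funext r; rw [pow_right_comm]
  rw [this, qDiff_pow hq]
  -- At x = q^{-m} the factor i = m of the q-binomial product vanishes.
  refine Finset.prod_eq_zero (Finset.mem_range.2 h) ?_
  rw [inv_pow, mul_inv_cancel₀ (pow_ne_zero _ hq0), sub_self]

theorem qDiff_eval_eq_zero {q : ℝ} (hq0 : q ≠ 0) (hq : |q| ≠ 1) {n : ℕ} {p : Polynomial ℝ}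
    (h : p.natDegree < n) : qDiff q n (fun r => p.eval (q⁻¹ ^ r)) = 0 := by
  simp only [Polynomial.eval_eq_sum_range' h]
  rw [qDiff_sum]
  refine Finset.sum_eq_zero fun m hm => ?_
  rw [qDiff_const_mul, qDiff_inv_pow_eq_zero hq0 hq (Finset.mem_range.1 hm), mul_zero]

/-- A partial fraction identity. In the induction the values at a and at a q⁻¹ share all denominator
factors but the outermost ones. -/
theorem qDiff_inv_one_sub {q : ℝ} (hq0 : q ≠ 0) (hq : |q| ≠ 1) (n : ℕ) (a : ℝ)
    (ha : ∀ r ≤ n, 1 - a * q⁻¹ ^ r ≠ 0) :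
    qDiff q n (fun r => (1 - a * q⁻¹ ^ r)⁻¹) =
      a ^ n * (∏ i ∈ Finset.range n, (1 - q⁻¹ ^ (i + 1))) /
        ∏ r ∈ Finset.range (n + 1), (1 - a * q⁻¹ ^ r) := by
  induction n generalizing a with
  | zero => simp [qDiff, gauss_self hq]
  | succ n ih =>
    have e : (fun r : ℕ => (1 - a * q⁻¹ ^ (r + 1))⁻¹) = fun r => (1 - a * q⁻¹ * q⁻¹ ^ r)⁻¹ := by
      funext r; ring
    have e2 : ∀ r : ℕ, 1 - a * q⁻¹ * q⁻¹ ^ r = 1 - a * q⁻¹ ^ (r + 1) := fun r => by ring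
    rw [qDiff_succ hq, e, ih a fun r hr => ha r (by omega), ih (a * q⁻¹) fun r hr => by
      rw [e2]; exact ha (r + 1) (by omega)]
    simp only [e2]
    have h0 := ha 0 (by omega)
    have hn := ha (n + 1) le_rfl
    have hm : ∏ r ∈ Finset.range n, (1 - a * q⁻¹ ^ (r + 1)) ≠ 0 :=
      Finset.prod_ne_zero_iff.2 fun r hr => ha _ (by have := Finset.mem_range.1 hr; omega)
    rw [Finset.prod_range_succ' (fun r => 1 - a * q⁻¹ ^ r) (n + 1),
      Finset.prod_range_succ' (fun r => 1 - a * q⁻¹ ^ r) n,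
      Finset.prod_range_succ (fun r => 1 - a * q⁻¹ ^ (r + 1)) n,
      Finset.prod_range_succ (fun r => 1 - q⁻¹ ^ (r + 1)) n]
    have hqn : q ^ n * q⁻¹ ^ n = 1 := by
      rw [← mul_pow, mul_inv_cancel₀ hq0, one_pow]
    have h3 : q ^ n * (a * q⁻¹) ^ n = a ^ n := by rw [mul_pow, mul_left_comm, hqn, mul_one]
    rw [← mul_div_assoc, ← mul_assoc, h3]
    generalize q⁻¹ ^ (n + 1) = y at *
    generalize ∏ r ∈ Finset.range n, (1 - a * q⁻¹ ^ (r + 1)) = D at *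
    rw [pow_zero] at h0 ⊢
    rw [mul_one] at h0 ⊢
    generalize ∏ r ∈ Finset.range n, (1 - q⁻¹ ^ (r + 1)) = C at *
    field_simp
    ring

/-- With y = q^{-r}, y^{m+1}/(1 - a y) = a⁻¹ y^m/(1 - a y) - a⁻¹ y^m, and the last term is killed
since m < n. -/
theorem qDiff_pow_div {q : ℝ} (hq0 : q ≠ 0) (hq : |q| ≠ 1) {m n : ℕ} (h : m ≤ n) {a : ℝ}
    (ha0 : a ≠ 0) (ha : ∀ r ≤ n, 1 - a * q⁻¹ ^ r ≠ 0) :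
    qDiff q n (fun r => (q⁻¹ ^ r) ^ m * (1 - a * q⁻¹ ^ r)⁻¹) =
      a⁻¹ ^ m * qDiff q n (fun r => (1 - a * q⁻¹ ^ r)⁻¹) := by
  induction m with
  | zero => simp
  | succ m ih =>
    rw [pow_succ, mul_right_comm, ← ih (by omega), mul_comm, ← qDiff_const_mul,
      ← sub_eq_zero, ← qDiff_sub]
    have : qDiff q n (fun r => -a⁻¹ * (q⁻¹ ^ r) ^ m) = 0 := by
      rw [qDiff_const_mul, qDiff_inv_pow_eq_zero hq0 hq (by omega), mul_zero]
    rw [← this]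
    refine qDiff_congr fun r hr => ?_
    have := ha r hr
    generalize q⁻¹ ^ r = y at *
    field_simp
    ring

/-- Behaves like a residue at y = 1/a: p(y) - p(1/a) is divisible by 1 - a y, with a quotient of
degree below n. -/
theorem qDiff_eval_div {q : ℝ} (hq0 : q ≠ 0) (hq : |q| ≠ 1) {n : ℕ} {p : Polynomial ℝ}
    (h : p.natDegree ≤ n) {a : ℝ} (ha0 : a ≠ 0) (ha : ∀ r ≤ n, 1 - a * q⁻¹ ^ r ≠ 0) :
    qDiff q n (fun r => p.eval (q⁻¹ ^ r) * (1 - a * q⁻¹ ^ r)⁻¹) =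
      p.eval a⁻¹ * qDiff q n (fun r => (1 - a * q⁻¹ ^ r)⁻¹) := by
  simp only [Polynomial.eval_eq_sum_range' (Nat.lt_succ_of_le h), Finset.sum_mul]
  rw [qDiff_sum]
  refine Finset.sum_congr rfl fun m hm => ?_
  simp only [mul_assoc]
  rw [qDiff_const_mul, qDiff_pow_div hq0 hq (by have := Finset.mem_range.1 hm; omega) ha0 ha]

/-! ### Biorthogonality of the coefficient sequences. -/

theorem prod_one_sub_pow_add {q : ℝ} (hq : |q| ≠ 1) (c m : ℕ) :
    ∏ i ∈ Finset.range m, (1 - q ^ (c + 1 + i)) = qPoch q (c + m) / qPoch q c := by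
  induction m with
  | zero => simp [qPoch_ne_zero hq c]
  | succ m ih =>
    rw [Finset.prod_range_succ, ih, ← add_assoc, qPoch_succ, add_right_comm c 1 m]
    ring

/-- The coefficient of `z^m` in the Laurent expansion of `Θ_{γ,δ}`. -/
def thetaCoeff (q : ℝ) (γ δ : ℕ) (m : ℤ) : ℝ :=
  qPoch q (δ + γ) * qPochInv q (δ + m) * qPochInv q (γ - m) * q ^ (m * (m + 1) / 2)

/-- The coefficients of the biorthogonal polynomials `p_n` without normalisation. -/
def pCoeff (q : ℝ) (γ δ n r : ℕ) : ℝ :=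
  (-1) ^ (n + r) * gauss q n r * (qPoch q (γ + r) / qPoch q (γ + n)) *
    ∏ i ∈ Finset.range (n - r), (1 - q ^ (δ + i))

/-- The coefficients of the biorthogonal polynomials `q_n` without normalisation. -/
def qCoeff (q : ℝ) (γ δ n r : ℕ) : ℝ := pCoeff q δ γ n r * q ^ (n - r)

/-- The squared norms of the unnormalised biorthogonal polynomials. -/
def biorthSq (q : ℝ) (γ δ n : ℕ) : ℝ :=
  (qPoch q n * qPoch q (δ + γ + n)) / (qPoch q (δ + n) * qPoch q (γ + n))

theorem biorthSq_ne_zero {q : ℝ} (hq : |q| ≠ 1) (γ δ n : ℕ) : biorthSq q γ δ n ≠ 0 := by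
  have := qPoch_ne_zero hq
  simp [biorthSq, this]

theorem pCoeff_of_lt (q : ℝ) (γ δ : ℕ) {n r : ℕ} (h : n < r) : pCoeff q γ δ n r = 0 := by
  simp [pCoeff, gauss_of_lt q h]

theorem qCoeff_of_lt (q : ℝ) (γ δ : ℕ) {n r : ℕ} (h : n < r) : qCoeff q γ δ n r = 0 := by
  simp [qCoeff, pCoeff_of_lt q δ γ h]

theorem pCoeff_self {q : ℝ} (hq : |q| ≠ 1) (γ δ n : ℕ) : pCoeff q γ δ n n = 1 := by
  simp [pCoeff, gauss_self hq, qPoch_ne_zero hq, ← two_mul]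

theorem qCoeff_self {q : ℝ} (hq : |q| ≠ 1) (γ δ n : ℕ) : qCoeff q γ δ n n = 1 := by
  simp [qCoeff, pCoeff_self hq]

theorem two_mul_choose_two (r : ℕ) : 2 * ((r.choose 2 : ℕ) : ℤ) = r * (r - 1) := by
  induction r with
  | zero => simp
  | succ r ih =>
    rw [Nat.choose_succ_succ' r 1, Nat.choose_one_right]
    push_cast
    linarith

theorem zpow_triangle {q : ℝ} (hq0 : q ≠ 0) (s r : ℕ) :
    q ^ ((((s : ℤ) - r) * ((s : ℤ) - r + 1)) / 2) =
      q ^ ((s + 1).choose 2) * q ^ (r.choose 2) * (q⁻¹ ^ r) ^ s := by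
  have h : (((s : ℤ) - r) * ((s : ℤ) - r + 1)) / 2 =
      ((s + 1).choose 2 : ℕ) + (r.choose 2 : ℕ) - (r * s : ℕ) := by
    have h1 := two_mul_choose_two r
    have h2 := two_mul_choose_two (s + 1)
    refine Int.ediv_eq_of_eq_mul_left two_ne_zero ?_
    push_cast at h2 ⊢
    linarith
  rw [h, zpow_sub₀ hq0, zpow_add₀ hq0, zpow_natCast, zpow_natCast, zpow_natCast, inv_pow, inv_pow,
    pow_mul, div_eq_mul_inv]

/-- Giving one factor q^{-r} to each of the s factors yields a polynomial of degree s in q^{-r}. -/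
theorem pow_mul_prod_eq_eval {q : ℝ} (hq0 : q ≠ 0) (γ r s : ℕ) :
    (q⁻¹ ^ r) ^ s * ∏ i ∈ Finset.range s, (1 - q ^ (((γ + r : ℕ) : ℤ) - i)) =
      (∏ i ∈ Finset.range s, (Polynomial.X - Polynomial.C (q ^ ((γ : ℤ) - i)))).eval
        (q⁻¹ ^ r) := by
  rw [Polynomial.eval_prod, ← Finset.card_range s, ← Finset.prod_const, Finset.card_range,
    ← Finset.prod_mul_distrib]
  refine Finset.prod_congr rfl fun i _ => ?_
  have : ((γ + r : ℕ) : ℤ) - i = ((γ : ℤ) - i) + r := by push_cast; ring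
  rw [this, zpow_add₀ hq0, zpow_natCast, Polynomial.eval_sub, Polynomial.eval_X,
    Polynomial.eval_C, mul_sub, mul_one, mul_left_comm, ← mul_pow, inv_mul_cancel₀ hq0, one_pow,
    mul_one]

theorem natDegree_prod_X_sub_C_le (c : ℕ → ℝ) (s : ℕ) :
    (∏ i ∈ Finset.range s, (Polynomial.X - Polynomial.C (c i))).natDegree ≤ s := by
  refine (Polynomial.natDegree_prod_le _ _).trans ?_
  simp

theorem prod_eq_eval_one_sub {q : ℝ} (hq0 : q ≠ 0) (t : ℕ) {r c : ℕ} (h : r ≤ c) :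
    ∏ i ∈ Finset.range t, (1 - q ^ (((c - r : ℕ) : ℤ) - i)) =
      (∏ i ∈ Finset.range t, (1 - Polynomial.C (q ^ ((c : ℤ) - i)) * Polynomial.X)).eval
        (q⁻¹ ^ r) := by
  rw [Polynomial.eval_prod]
  refine Finset.prod_congr rfl fun i _ => ?_
  have : ((c - r : ℕ) : ℤ) - i = ((c : ℤ) - i) - r := by push_cast [h]; ring
  rw [this, zpow_sub₀ hq0, zpow_natCast]
  simp [div_eq_mul_inv]

theorem natDegree_prod_one_sub_le (c : ℕ → ℝ) (t : ℕ) :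
    (∏ i ∈ Finset.range t, (1 - Polynomial.C (c i) * Polynomial.X)).natDegree ≤ t := by
  refine (Polynomial.natDegree_prod_le _ _).trans ?_
  have : ∀ i ∈ Finset.range t, (1 - Polynomial.C (c i) * Polynomial.X).natDegree ≤ 1 := by
    intro i _
    compute_degree
  simpa using Finset.sum_le_card_nsmul _ _ 1 this

/-- Isolates the dependence on r: the `qDiff` weight, a polynomial in q^{-r}, and a Pochhammer
ratio. Writing δ + 1 lets the rising product in `pCoeff` become a quotient by (q;q)_δ. -/
theorem pCoeff_mul_thetaCoeff {q : ℝ} (hq0 : q ≠ 0) (hq : |q| ≠ 1) (γ δ : ℕ) {n r : ℕ} (s : ℕ)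
    (hr : r ≤ n) :
    pCoeff q γ (δ + 1) n r * thetaCoeff q γ (δ + 1) ((s : ℤ) - r) =
      ((-1) ^ n * qPoch q (δ + 1 + γ) * q ^ ((s + 1).choose 2) / (qPoch q (γ + n) * qPoch q δ)) *
      ((-1) ^ r * gauss q n r * q ^ (r.choose 2) *
        ((∏ i ∈ Finset.range s, (Polynomial.X - Polynomial.C (q ^ ((γ : ℤ) - i)))).eval (q⁻¹ ^ r) *
          (qPoch q (δ + n - r) * qPochInv q ((δ + 1 : ℕ) + ((s : ℤ) - r))))) := by
  have e : δ + (n - r) = δ + n - r := by omega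
  have e1 : (γ : ℤ) - ((s : ℤ) - r) = ((γ + r : ℕ) : ℤ) - s := by push_cast; ring
  have := prod_one_sub_pow_add hq δ (n - r)
  rw [e] at this
  rw [pCoeff, thetaCoeff, zpow_triangle hq0, this, ← pow_mul_prod_eq_eval hq0,
    ← qPoch_mul_qPochInv_sub hq, e1, pow_add]
  ring

theorem sum_pCoeff_mul_thetaCoeff_eq_zero {q : ℝ} (hq0 : q ≠ 0) (hq : |q| ≠ 1) (γ δ : ℕ)
    {n s : ℕ} (h : s < n) :
    ∑ r ∈ Finset.range (n + 1), pCoeff q γ δ n r * thetaCoeff q γ δ ((s : ℤ) - r) = 0 := by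
  rcases δ with _ | δ
  -- For δ = 0 the factor i = 0 removes every coefficient except r = n, and there the symbol
  -- coefficient vanishes because s - n < 0.
  · refine Finset.sum_eq_zero fun r hr => ?_
    rcases (Nat.lt_succ_iff.1 (Finset.mem_range.1 hr)).lt_or_eq with h1 | rfl
    · have : ∏ i ∈ Finset.range (n - r), (1 - q ^ (0 + i)) = 0 :=
        Finset.prod_eq_zero (Finset.mem_range.2 (Nat.sub_pos_of_lt h1)) (by simp)
      rw [pCoeff, this, mul_zero, zero_mul]
    · rw [thetaCoeff, qPochInv_of_neg q (m := ((0 : ℕ) : ℤ) + _) (by push_cast; omega)]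
      ring
  · obtain ⟨t, rfl⟩ := Nat.exists_eq_add_of_lt h
    -- Here n = s + t + 1, and the Pochhammer ratio is a polynomial of degree at most t, so the
    -- total degree is at most n - 1.
    have key := qDiff_eval_eq_zero hq0 hq (n := s + t + 1)
      (p := (∏ i ∈ Finset.range s, (Polynomial.X - Polynomial.C (q ^ ((γ : ℤ) - i)))) *
        ∏ i ∈ Finset.range t, (1 - Polynomial.C (q ^ (((δ + (s + t + 1) : ℕ) : ℤ) - i)) *
          Polynomial.X))
      (Nat.lt_succ_of_le (Polynomial.natDegree_mul_le.trans (add_le_add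
        (natDegree_prod_X_sub_C_le _ s) (natDegree_prod_one_sub_le _ t))))
    rw [Finset.sum_congr rfl fun r hr => pCoeff_mul_thetaCoeff hq0 hq γ δ s
      (Nat.lt_succ_iff.1 (Finset.mem_range.1 hr)), ← Finset.mul_sum]
    refine mul_eq_zero_of_right _ (Eq.trans ?_ key)
    refine Finset.sum_congr rfl fun r hr => ?_
    have hr' := Finset.mem_range.1 hr
    have e : (((δ + 1 : ℕ) : ℤ) + ((s : ℤ) - r)) = ((δ + (s + t + 1) - r : ℕ) : ℤ) - t := by
      omega
    rw [e, qPoch_mul_qPochInv_sub hq, prod_eq_eval_one_sub hq0 t (by omega)]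
    simp only [Polynomial.eval_mul]

theorem sum_pCoeff_mul_thetaCoeff_self {q : ℝ} (hq0 : q ≠ 0) (hq : |q| ≠ 1) (γ δ n : ℕ) :
    ∑ r ∈ Finset.range (n + 1), pCoeff q γ δ n r * thetaCoeff q γ δ ((n : ℤ) - r) =
      biorthSq q γ δ n := by
  have hP := qPoch_ne_zero hq
  rcases δ with _ | δ
  · rw [Finset.sum_range_succ, Finset.sum_eq_zero, zero_add, pCoeff_self hq, thetaCoeff]
    · simp [qPochInv, qPoch_zero, biorthSq, hP]
    · intro r hr
      have : ∏ i ∈ Finset.range (n - r), (1 - q ^ (0 + i)) = 0 :=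
        Finset.prod_eq_zero (Finset.mem_range.2 (Nat.sub_pos_of_lt (Finset.mem_range.1 hr)))
          (by simp)
      rw [pCoeff, this, mul_zero, zero_mul]
  -- This makes 1 - a q^{-r} the one factor of (q;q)_{δ+1+n-r} that (q;q)_{δ+n-r} leaves
  -- uncancelled.
  · set a : ℝ := q ^ (δ + 1 + n) with ha_def
    have ha0 : a ≠ 0 := pow_ne_zero _ hq0
    have hax : ∀ r ≤ n, 1 - a * q⁻¹ ^ r = 1 - q ^ (δ + 1 + n - r) := by
      intro r hr
      have : q ^ (δ + 1 + n) = q ^ (δ + 1 + n - r) * q ^ r := by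
        rw [← pow_add]; congr 1; omega
      rw [ha_def, this, mul_assoc, ← mul_pow, mul_inv_cancel₀ hq0, one_pow, mul_one]
    have ha : ∀ r ≤ n, 1 - a * q⁻¹ ^ r ≠ 0 := by
      intro r hr
      rw [hax r hr]
      exact one_sub_pow_ne_zero hq (by omega)
    rw [Finset.sum_congr rfl fun r hr => pCoeff_mul_thetaCoeff hq0 hq γ δ n
      (Nat.lt_succ_iff.1 (Finset.mem_range.1 hr)), ← Finset.mul_sum]
    have key := qDiff_eval_div hq0 hq (natDegree_prod_X_sub_C_le (fun i => q ^ ((γ : ℤ) - i)) n)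
      ha0 ha
    rw [qDiff_inv_one_sub hq0 hq n a ha] at key
    have e0 : ∑ r ∈ Finset.range (n + 1), (-1) ^ r * gauss q n r * q ^ (r.choose 2) *
        ((∏ i ∈ Finset.range n, (Polynomial.X - Polynomial.C (q ^ ((γ : ℤ) - i)))).eval (q⁻¹ ^ r) *
          (qPoch q (δ + n - r) * qPochInv q ((δ + 1 : ℕ) + ((n : ℤ) - r)))) =
        qDiff q n (fun r => (∏ i ∈ Finset.range n,
          (Polynomial.X - Polynomial.C (q ^ ((γ : ℤ) - i)))).eval (q⁻¹ ^ r) *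
            (1 - a * q⁻¹ ^ r)⁻¹) := by
      refine Finset.sum_congr rfl fun r hr => ?_
      have hr' := Nat.lt_succ_iff.1 (Finset.mem_range.1 hr)
      have e1 : (((δ + 1 : ℕ) : ℤ) + ((n : ℤ) - r)) = ((δ + n - r + 1 : ℕ) : ℤ) := by omega
      have e2 : δ + 1 + n - r = δ + n - r + 1 := by omega
      simp only
      rw [hax r hr', e1, e2, qPochInv_natCast, qPoch_succ]
      have := hP (δ + n - r)
      congr 2
      rw [mul_inv, ← mul_assoc, mul_inv_cancel₀ this, one_mul]
    rw [e0, key]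
    have e3 : (∏ i ∈ Finset.range n, (Polynomial.X - Polynomial.C (q ^ ((γ : ℤ) - i)))).eval a⁻¹ *
        a ^ n = qPoch q (δ + 1 + γ + n) / qPoch q (δ + 1 + γ) := by
      rw [← prod_one_sub_pow_add hq, Polynomial.eval_prod, ← Finset.prod_range_reflect,
        ← Finset.card_range n, ← Finset.prod_const, Finset.card_range, ← Finset.prod_mul_distrib]
      refine Finset.prod_congr rfl fun i hi => ?_
      have hi' := Finset.mem_range.1 hi
      have : q ^ ((γ : ℤ) - ((n - 1 - i : ℕ) : ℤ)) * a = q ^ (δ + 1 + γ + 1 + i) := by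
        rw [ha_def, ← zpow_natCast, ← zpow_natCast, ← zpow_add₀ hq0]
        congr 1
        omega
      rw [Polynomial.eval_sub, Polynomial.eval_X, Polynomial.eval_C, sub_mul,
        inv_mul_cancel₀ ha0, this]
    have e4 : ∏ r ∈ Finset.range (n + 1), (1 - a * q⁻¹ ^ r) =
        qPoch q (δ + 1 + n) / qPoch q δ := by
      have := prod_one_sub_pow_add hq δ (n + 1)
      rw [add_comm n 1, ← add_assoc] at this
      rw [← this, add_comm 1 n, ← Finset.prod_range_reflect]
      refine Finset.prod_congr rfl fun i hi => ?_
      have hi' := Finset.mem_range.1 hi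
      rw [hax _ (by omega)]
      congr 2
      omega
    have e5 : q ^ ((n + 1).choose 2) * ∏ i ∈ Finset.range n, (1 - q⁻¹ ^ (i + 1)) =
        (-1) ^ n * qPoch q n := by
      clear * - hq0
      induction n with
      | zero => simp [qPoch_zero]
      | succ n ih =>
        have hc : (n + 1 + 1).choose 2 = (n + 1) + (n + 1).choose 2 := by
          rw [Nat.choose_succ_succ' (n + 1) 1, Nat.choose_one_right]
        have hn : q ^ (n + 1) * q⁻¹ ^ (n + 1) = 1 := by
          rw [← mul_pow, mul_inv_cancel₀ hq0, one_pow]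
        rw [hc, Finset.prod_range_succ, qPoch_succ, pow_add]
        linear_combination (q ^ (n + 1) * (1 - q⁻¹ ^ (n + 1))) * ih - (-1) ^ n * qPoch q n * hn
    have s1 : ((-1 : ℝ) ^ n) * (-1) ^ n = 1 := by rw [← mul_pow]; norm_num
    rw [e4, biorthSq]
    generalize (∏ i ∈ Finset.range n, (Polynomial.X - Polynomial.C (q ^ ((γ : ℤ) - i)))).eval a⁻¹
      = U at *
    generalize ∏ i ∈ Finset.range n, (1 - q⁻¹ ^ (i + 1)) = W at *
    generalize q ^ ((n + 1).choose 2) = Z at *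
    have h1 := hP (δ + 1 + γ)
    have h2 := hP (γ + n)
    have h3 := hP δ
    have h4 := hP (δ + 1 + n)
    calc _ = (-1) ^ n * (Z * W) * (U * a ^ n) * qPoch q (δ + 1 + γ) /
          (qPoch q (γ + n) * qPoch q (δ + 1 + n)) := by field_simp
      _ = _ := by
        rw [e5, e3, ← mul_assoc, s1]
        field_simp

/-- The coefficient form of Θ_{γ,δ}(z) = Θ_{δ,γ}(1/(qz)). -/
theorem thetaCoeff_swap {q : ℝ} (hq0 : q ≠ 0) (γ δ : ℕ) (m : ℤ) :
    thetaCoeff q γ δ m = thetaCoeff q δ γ (-m) * q ^ m := by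
  have h : m * (m + 1) / 2 = -m * (-m + 1) / 2 + m := by
    have : m * (m + 1) = -m * (-m + 1) + m * 2 := by ring
    rw [this, Int.add_mul_ediv_right _ _ two_ne_zero]
  rw [thetaCoeff, thetaCoeff, h, zpow_add₀ hq0, add_comm δ γ, sub_neg_eq_add, ← sub_eq_add_neg]
  ring

theorem sum_qCoeff_mul_thetaCoeff_eq_zero {q : ℝ} (hq0 : q ≠ 0) (hq : |q| ≠ 1) (γ δ : ℕ)
    {n r : ℕ} (h : r < n) :
    ∑ s ∈ Finset.range (n + 1), qCoeff q γ δ n s * thetaCoeff q γ δ ((s : ℤ) - r) = 0 := by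
  have key := sum_pCoeff_mul_thetaCoeff_eq_zero hq0 hq δ γ h
  rw [← mul_zero (q ^ ((n : ℤ) - r)), ← key, Finset.mul_sum]
  refine Finset.sum_congr rfl fun s hs => ?_
  have hs' := Nat.lt_succ_iff.1 (Finset.mem_range.1 hs)
  -- The q^{n-s} built into `qCoeff` and the q^{s-r} from the swap combine to a factor independent
  -- of s.
  have e : q ^ ((n : ℤ) - r) = q ^ (n - s) * q ^ ((s : ℤ) - r) := by
    rw [← zpow_natCast, ← zpow_add₀ hq0]
    congr 1
    omega
  rw [thetaCoeff_swap hq0 γ δ, neg_sub, qCoeff, e]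
  ring

/-- The larger degree supplies the vanishing. If m < n, the sum over s is zero for each r ≤ m. If m
≥ n, the sum over r is zero unless s = m, which forces m = n and leaves the norm, since q_n is monic
before normalization. -/
theorem sum_qCoeff_thetaCoeff_pCoeff {q : ℝ} (hq0 : q ≠ 0) (hq : |q| ≠ 1) (γ δ m n : ℕ) :
    ∑ s ∈ Finset.range (n + 1), ∑ r ∈ Finset.range (m + 1),
      qCoeff q γ δ n s * thetaCoeff q γ δ ((s : ℤ) - r) * pCoeff q γ δ m r =
        if m = n then biorthSq q γ δ n else 0 := by
  rcases lt_or_ge m n with h | h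
  · rw [if_neg h.ne, Finset.sum_comm]
    refine Finset.sum_eq_zero fun r hr => ?_
    rw [← Finset.sum_mul, sum_qCoeff_mul_thetaCoeff_eq_zero hq0 hq γ δ
      (lt_of_le_of_lt (Nat.lt_succ_iff.1 (Finset.mem_range.1 hr)) h), zero_mul]
  · have inner : ∀ s ∈ Finset.range (n + 1), ∑ r ∈ Finset.range (m + 1),
        qCoeff q γ δ n s * thetaCoeff q γ δ ((s : ℤ) - r) * pCoeff q γ δ m r =
          if s = m then biorthSq q γ δ n else 0 := by
      intro s hs
      have hs' := Nat.lt_succ_iff.1 (Finset.mem_range.1 hs)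
      have e : ∑ r ∈ Finset.range (m + 1),
          qCoeff q γ δ n s * thetaCoeff q γ δ ((s : ℤ) - r) * pCoeff q γ δ m r =
          qCoeff q γ δ n s * ∑ r ∈ Finset.range (m + 1),
            pCoeff q γ δ m r * thetaCoeff q γ δ ((s : ℤ) - r) := by
        rw [Finset.mul_sum]
        exact Finset.sum_congr rfl fun r _ => by ring
      rw [e]
      split_ifs with hsm
      · obtain rfl : s = n := by omega
        subst hsm
        rw [sum_pCoeff_mul_thetaCoeff_self hq0 hq, qCoeff_self hq, one_mul]
      · rw [sum_pCoeff_mul_thetaCoeff_eq_zero hq0 hq γ δ (by omega), mul_zero]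
    rw [Finset.sum_congr rfl inner, Finset.sum_ite_eq']
    by_cases hmn : m = n
    · simp [hmn]
    · rw [if_neg hmn, if_neg]
      simp
      omega

/-! ### Triangular factorization, determinant and inverse. -/

/-- The real Toeplitz matrix of the Laurent coefficients of `Θ_{γ,δ}`. -/
def thetaToeplitz (q : ℝ) (γ δ N : ℕ) : Matrix (Fin N) (Fin N) ℝ :=
  Matrix.of fun a b => thetaCoeff q γ δ ((a : ℤ) - b)

/-- The coefficient matrix of the unnormalised `p_n`. -/
def pMat (q : ℝ) (γ δ N : ℕ) : Matrix (Fin N) (Fin N) ℝ :=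
  Matrix.of fun n r => pCoeff q γ δ n r

/-- The coefficient matrix of the unnormalised `q_n`. -/
def qMat (q : ℝ) (γ δ N : ℕ) : Matrix (Fin N) (Fin N) ℝ :=
  Matrix.of fun n r => qCoeff q γ δ n r

theorem sum_fin_eq_sum_range_of_lt {N n : ℕ} (hn : n < N) {f : ℕ → ℝ}
    (hf : ∀ r, n < r → f r = 0) : ∑ r : Fin N, f r = ∑ r ∈ Finset.range (n + 1), f r := by
  rw [Fin.sum_univ_eq_sum_range]
  refine (Finset.sum_subset (Finset.range_subset_range.2 hn) fun r _ hr => hf r ?_).symm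
  simpa using hr

/-- Biorthogonality as a matrix identity; triangularity cuts the sums over `Fin N` down to the
degrees. -/
theorem qMat_mul_thetaToeplitz_mul {q : ℝ} (hq0 : q ≠ 0) (hq : |q| ≠ 1) (γ δ N : ℕ) :
    qMat q γ δ N * thetaToeplitz q γ δ N * (pMat q γ δ N).transpose =
      Matrix.diagonal fun n : Fin N => biorthSq q γ δ n := by
  ext n m
  rw [Matrix.mul_apply]
  simp only [Matrix.mul_apply, qMat, thetaToeplitz, pMat, Matrix.of_apply, Matrix.transpose_apply]
  have h := sum_qCoeff_thetaCoeff_pCoeff hq0 hq γ δ m n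
  rw [Finset.sum_comm] at h
  rw [sum_fin_eq_sum_range_of_lt m.2 (f := fun r => (∑ s : Fin N,
    qCoeff q γ δ n s * thetaCoeff q γ δ ((s : ℤ) - r)) * pCoeff q γ δ m r)
    fun r hr => by rw [pCoeff_of_lt q γ δ hr, mul_zero]]
  rw [Matrix.diagonal_apply]
  have e : ((m : ℕ) = n) = (n = m) := propext (by rw [Fin.ext_iff]; exact eq_comm)
  simp only [e] at h
  rw [← h]
  refine Finset.sum_congr rfl fun r _ => ?_
  rw [sum_fin_eq_sum_range_of_lt n.2 (f := fun s => qCoeff q γ δ n s *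
    thetaCoeff q γ δ ((s : ℤ) - r)) fun s hs => by rw [qCoeff_of_lt q γ δ hs, zero_mul],
    Finset.sum_mul]

theorem det_pMat {q : ℝ} (hq : |q| ≠ 1) (γ δ N : ℕ) : (pMat q γ δ N).det = 1 := by
  have h : (pMat q γ δ N).IsLowerTriangular := fun a b hab => pCoeff_of_lt q γ δ hab
  rw [Matrix.det_of_isLowerTriangular _ h]
  exact Finset.prod_eq_one fun n _ => pCoeff_self hq γ δ n

theorem det_qMat {q : ℝ} (hq : |q| ≠ 1) (γ δ N : ℕ) : (qMat q γ δ N).det = 1 := by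
  have h : (qMat q γ δ N).IsLowerTriangular := fun a b hab => qCoeff_of_lt q γ δ hab
  rw [Matrix.det_of_isLowerTriangular _ h]
  exact Finset.prod_eq_one fun n _ => qCoeff_self hq γ δ n

theorem det_thetaToeplitz_eq_prod {q : ℝ} (hq0 : q ≠ 0) (hq : |q| ≠ 1) (γ δ N : ℕ) :
    (thetaToeplitz q γ δ N).det = ∏ n ∈ Finset.range N, biorthSq q γ δ n := by
  have h := congrArg Matrix.det (qMat_mul_thetaToeplitz_mul hq0 hq γ δ N)
  rw [Matrix.det_mul, Matrix.det_mul, Matrix.det_transpose, det_pMat hq, det_qMat hq,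
    Matrix.det_diagonal, one_mul, mul_one] at h
  rw [h, Fin.prod_univ_eq_prod_range (fun n => biorthSq q γ δ n)]

theorem det_thetaToeplitz_ne_zero {q : ℝ} (hq0 : q ≠ 0) (hq : |q| ≠ 1) (γ δ N : ℕ) :
    (thetaToeplitz q γ δ N).det ≠ 0 := by
  rw [det_thetaToeplitz_eq_prod hq0 hq]
  exact Finset.prod_ne_zero_iff.2 fun n _ => biorthSq_ne_zero hq γ δ n

theorem one_sub_ne_zero {q : ℝ} (hq : |q| ≠ 1) : 1 - q ≠ 0 := by
  simpa using one_sub_pow_ne_zero hq one_ne_zero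

theorem qGamma_succ (q : ℝ) (k : ℕ) : qGamma q (k + 1) = qPoch q k / (1 - q) ^ k := rfl

theorem qGamma_succ_ne_zero {q : ℝ} (hq : |q| ≠ 1) (k : ℕ) : qGamma q (k + 1) ≠ 0 :=
  div_ne_zero (qPoch_ne_zero hq k) (pow_ne_zero _ (one_sub_ne_zero hq))

theorem qGamma_one (q : ℝ) : qGamma q 1 = 1 := by simp [qGamma, qPoch]

theorem qBarnes_one (q : ℝ) : qBarnes q 1 = 1 := by simp [qBarnes]

theorem qBarnes_succ_succ (q : ℝ) (k : ℕ) :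
    qBarnes q (k + 2) = qBarnes q (k + 1) * qGamma q (k + 1) := by
  rcases k with _ | k
  · simp [qBarnes, qGamma_one]
  · exact Finset.prod_Icc_succ_top (by omega) _

theorem qBarnes_succ_ne_zero {q : ℝ} (hq : |q| ≠ 1) (k : ℕ) : qBarnes q (k + 1) ≠ 0 :=
  Finset.prod_ne_zero_iff.2 fun i _ => qGamma_succ_ne_zero hq i

/-- Raising N by one multiplies the right side by `biorthSq q γ δ N`; the powers of 1 - q balance
because N + (δ + γ + N) = (δ + N) + (γ + N). -/
theorem det_thetaToeplitz {q : ℝ} (hq0 : q ≠ 0) (hq : |q| ≠ 1) (γ δ N : ℕ) :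
    (thetaToeplitz q γ δ N).det = qBarnes q (N + 1)
      * (qBarnes q (δ + γ + N + 1) / qBarnes q (δ + γ + 1))
      * (qBarnes q (δ + 1) / qBarnes q (δ + N + 1))
      * (qBarnes q (γ + 1) / qBarnes q (γ + N + 1)) := by
  rw [det_thetaToeplitz_eq_prod hq0 hq]
  have hB := qBarnes_succ_ne_zero hq
  induction N with
  | zero =>
    have h1 := hB (δ + γ)
    have h2 := hB δ
    have h3 := hB γ
    simp [qBarnes_one, h1, h2, h3]
  | succ N ih =>
    rw [Finset.prod_range_succ, ih, ← add_assoc, ← add_assoc, ← add_assoc, qBarnes_succ_succ,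
      qBarnes_succ_succ, qBarnes_succ_succ, qBarnes_succ_succ, biorthSq, qGamma_succ, qGamma_succ,
      qGamma_succ, qGamma_succ]
    have h1 := hB (δ + γ)
    have h2 := hB (δ + N)
    have h3 := hB (γ + N)
    have h4 := qPoch_ne_zero hq (δ + N)
    have h5 := qPoch_ne_zero hq (γ + N)
    have h6 := one_sub_ne_zero hq
    simp only [pow_add]
    field_simp

theorem prod_Icc_one_eq_prod_range {M : Type*} [CommMonoid M] (f : ℕ → M) (m : ℕ) :
    ∏ i ∈ Finset.Icc 1 m, f i = ∏ i ∈ Finset.range m, f (i + 1) := by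
  induction m with
  | zero => simp
  | succ m ih => rw [Finset.prod_Icc_succ_top (by omega), ih, Finset.prod_range_succ]

theorem qBinom_sub_one (q : ℝ) (c m : ℕ) :
    qBinom q ((c : ℤ) + m - 1) m = (∏ i ∈ Finset.range m, (1 - q ^ (c + i))) / qPoch q m := by
  rw [qBinom, qPoch, Finset.prod_div_distrib]
  congr 1
  rw [prod_Icc_one_eq_prod_range]
  refine Finset.prod_congr rfl fun i _ => ?_
  have : (c : ℤ) + m - 1 - m + ((i + 1 : ℕ) : ℤ) = ((c + i : ℕ) : ℤ) := by push_cast; ring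
  rw [this, zpow_natCast]

/-- The q-binomials of the form [c + m - 1, m] are exactly the rising products of `pCoeff` over
(q;q)_m, which also covers γ = 0 and δ = 0. -/
theorem biorth_term_eq {q : ℝ} (hq : |q| ≠ 1) (γ δ : ℕ) {a b r : ℕ} (ha : a ≤ r) (hb : b ≤ r) :
    pCoeff q γ δ r a * qCoeff q γ δ r b / biorthSq q γ δ r =
      (-1) ^ (a + b) * q ^ (r - b) * ((qGamma q (γ + a + 1) * qGamma q (δ + b + 1) *
        qGamma q (r + 1)) / (qGamma q (a + 1) * qGamma q (b + 1) * qGamma q (δ + γ + r + 1))) *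
        qBinom q ((γ : ℤ) + r - b - 1) (r - b) * qBinom q ((δ : ℤ) + r - a - 1) (r - a) := by
  obtain ⟨k, rfl⟩ := Nat.exists_eq_add_of_le ha
  obtain ⟨l, hl⟩ := Nat.exists_eq_add_of_le hb
  have e1 : (γ : ℤ) + ((a + k : ℕ) : ℤ) - b - 1 = (γ : ℤ) + l - 1 := by omega
  have e2 : (δ : ℤ) + ((a + k : ℕ) : ℤ) - a - 1 = (δ : ℤ) + k - 1 := by omega
  have e3 : ((a + k : ℕ) : ℤ) - b = l := by omega
  have e4 : ((a + k : ℕ) : ℤ) - a = k := by omega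
  have e5 : a + k - b = l := by omega
  have e6 : a + k - a = k := by omega
  rw [e1, e2, e5, e6, qBinom_sub_one, qBinom_sub_one, qCoeff, pCoeff, pCoeff, e5, e6, gauss,
    gauss, e3, e4, biorthSq]
  simp only [qGamma_succ, qPochInv_natCast]
  have hP := qPoch_ne_zero hq
  have h1 := hP a
  have h2 := hP b
  have h3 := hP k
  have h4 := hP l
  have h5 := hP (a + k)
  have h6 := hP (γ + (a + k))
  have h7 := hP (δ + (a + k))
  have h8 := hP (δ + γ + (a + k))
  have h9 := one_sub_ne_zero hq
  have s : (-1 : ℝ) ^ (a + k + a) * (-1) ^ (a + k + b) = (-1) ^ (a + b) := by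
    rw [← pow_add, show a + k + a + (a + k + b) = 2 * (a + k) + (a + b) by ring, pow_add, pow_mul]
    simp
  rw [← s]
  simp only [pow_add]
  field_simp

/-- The explicit entries of the inverse Toeplitz matrix. -/
def thetaInv (q : ℝ) (γ δ N a b : ℕ) : ℝ :=
  ∑ r ∈ Finset.Icc (max a b) N, (-1) ^ (a + b) * q ^ (r - b) *
    ((qGamma q (γ + a + 1) * qGamma q (δ + b + 1) * qGamma q (r + 1)) /
      (qGamma q (a + 1) * qGamma q (b + 1) * qGamma q (δ + γ + r + 1))) *
    qBinom q ((γ : ℤ) + r - b - 1) (r - b) * qBinom q ((δ : ℤ) + r - a - 1) (r - a)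

theorem thetaToeplitz_inv {q : ℝ} (hq0 : q ≠ 0) (hq : |q| ≠ 1) (γ δ N : ℕ) :
    (thetaToeplitz q γ δ (N + 1))⁻¹ =
      Matrix.of fun a b : Fin (N + 1) => thetaInv q γ δ N a b := by
  set P := pMat q γ δ (N + 1)
  set Q := qMat q γ δ (N + 1)
  set T := thetaToeplitz q γ δ (N + 1)
  set W : Matrix (Fin (N + 1)) (Fin (N + 1)) ℝ :=
    Matrix.diagonal fun n => (biorthSq q γ δ n)⁻¹
  -- A one-sided inverse of a square matrix is two-sided, so D⁻¹ Q T Pᵀ = 1 may be turned round to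
  -- Pᵀ D⁻¹ Q T = 1.
  have h1 : (W * Q * T) * P.transpose = 1 := by
    rw [mul_assoc W, mul_assoc W, qMat_mul_thetaToeplitz_mul hq0 hq, Matrix.diagonal_mul_diagonal,
      ← Matrix.diagonal_one]
    congr 1
    funext n
    exact inv_mul_cancel₀ (biorthSq_ne_zero hq γ δ n)
  have h2 : (P.transpose * (W * Q)) * T = 1 := by
    rw [mul_assoc]
    exact mul_eq_one_comm.1 h1
  rw [Matrix.inv_eq_left_inv h2]
  ext a b
  have e : (P.transpose * (W * Q)) a b =
      ∑ r : Fin (N + 1), pCoeff q γ δ r a * qCoeff q γ δ r b / biorthSq q γ δ r := by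
    rw [Matrix.mul_apply]
    refine Finset.sum_congr rfl fun r _ => ?_
    rw [Matrix.diagonal_mul]
    simp only [P, Q, pMat, qMat, Matrix.transpose_apply, Matrix.of_apply]
    ring
  rw [e, Fin.sum_univ_eq_sum_range (fun r => pCoeff q γ δ r a * qCoeff q γ δ r b /
    biorthSq q γ δ r) (N + 1), Matrix.of_apply, thetaInv]
  have sub : Finset.Icc (max (a : ℕ) b) N ⊆ Finset.range (N + 1) := fun r hr => by
    simp at hr ⊢; omega
  rw [← Finset.sum_subset sub]
  · refine Finset.sum_congr rfl fun r hr => ?_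
    have := Finset.mem_Icc.1 hr
    exact biorth_term_eq hq γ δ (le_trans (le_max_left _ _) this.1)
      (le_trans (le_max_right _ _) this.1)
  · intro r hr hr2
    simp only [Finset.mem_range, Finset.mem_Icc, not_and, not_le] at hr hr2
    by_cases ha : r < a
    · rw [pCoeff_of_lt q γ δ ha]; simp
    · rw [qCoeff_of_lt q γ δ (n := r) (r := b) (by by_contra hb; have := hr2 (by simp; omega); omega)]
      simp

/-! ### Laurent expansion of the symbol and its Fourier coefficients. -/

theorem gauss_eq_div {q : ℝ} {n r : ℕ} (h : r ≤ n) :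
    gauss q n r = qPoch q n / (qPoch q r * qPoch q (n - r)) := by
  rw [gauss, ← Nat.cast_sub h, qPochInv_natCast, qPochInv_natCast, mul_assoc, ← mul_inv,
    div_eq_mul_inv]

theorem qBinom_natCast {q : ℝ} (hq : |q| ≠ 1) {n r : ℕ} (h : r ≤ n) :
    qBinom q n r = gauss q n r := by
  have h1 := qPoch_ne_zero hq r
  have h2 := qPoch_ne_zero hq (n - r)
  have h3 := one_sub_ne_zero hq
  rw [qBinom_eq_qGamma hq h, gauss_eq_div h, qGamma_succ, qGamma_succ, qGamma_succ]
  nth_rewrite 2 [← Nat.add_sub_cancel' h]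
  rw [pow_add]
  field_simp

/-- Lifting `qDiff_pow` to a polynomial identity carries it to complex arguments and to power
series. -/
theorem prod_one_sub_C_pow_mul_X {q : ℝ} (hq : |q| ≠ 1) (n : ℕ) :
    ∏ i ∈ Finset.range n, (1 - Polynomial.C (q ^ i) * Polynomial.X) =
      ∑ k ∈ Finset.range (n + 1),
        Polynomial.C ((-1) ^ k * gauss q n k * q ^ (k.choose 2)) * Polynomial.X ^ k := by
  refine Polynomial.funext fun y => ?_
  simp only [Polynomial.eval_prod, Polynomial.eval_finsetSum, Polynomial.eval_sub,
    Polynomial.eval_mul, Polynomial.eval_C, Polynomial.eval_X, Polynomial.eval_one,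
    Polynomial.eval_pow]
  exact (qDiff_pow hq n y).symm

/-- The `q`-binomial theorem over the complex numbers. -/
theorem prod_one_add_pow_mul {q : ℝ} (hq : |q| ≠ 1) (n : ℕ) (x : ℂ) :
    ∏ i ∈ Finset.range n, (1 + (q : ℂ) ^ i * x) =
      ∑ k ∈ Finset.range (n + 1), ((gauss q n k * q ^ (k.choose 2) : ℝ) : ℂ) * x ^ k := by
  have h := congrArg (Polynomial.aeval (-x)) (prod_one_sub_C_pow_mul_X hq n)
  simp only [map_prod, map_sum, map_sub, map_mul, map_one, map_pow, Polynomial.aeval_C,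
    Polynomial.aeval_X, mul_neg, sub_neg_eq_add, Complex.coe_algebraMap] at h
  rw [h]
  refine Finset.sum_congr rfl fun k _ => ?_
  have s : (-1 : ℂ) ^ k * (-1) ^ k = 1 := by rw [← mul_pow]; simp
  rw [neg_pow x]
  push_cast
  linear_combination ((gauss q n k : ℂ) * (q : ℂ) ^ k.choose 2 * x ^ k) * s

theorem thetaSymbol_eq_sum {q : ℝ} (hq0 : q ≠ 0) (hq : |q| ≠ 1) (γ δ : ℕ) {z : ℂ} (hz : z ≠ 0) :
    thetaSymbol q γ δ z =
      ∑ m ∈ Finset.Icc (-(δ : ℤ)) (γ : ℤ), (thetaCoeff q γ δ m : ℂ) * z ^ m := by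
  have hqC : (q : ℂ) ≠ 0 := by exact_mod_cast hq0
  -- Since 1 + q^j z⁻¹ = q^j z⁻¹ (1 + q^{-j} z), all δ + γ factors take the form 1 + q^i y with
  -- consecutive i.
  set y : ℂ := (q : ℂ) * z * (q : ℂ)⁻¹ ^ δ with hy
  have hprod : thetaSymbol q γ δ z =
      z⁻¹ ^ δ * (q : ℂ) ^ (δ.choose 2) * ∏ i ∈ Finset.range (δ + γ), (1 + (q : ℂ) ^ i * y) := by
    rw [thetaSymbol, Finset.prod_range_add, prod_Icc_one_eq_prod_range, ← mul_assoc]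
    congr 1
    · have : (q : ℂ) ^ (δ.choose 2) = ∏ i ∈ Finset.range δ, (q : ℂ) ^ i := by
        rw [Finset.prod_pow_eq_pow_sum, Finset.sum_range_id, Nat.choose_two_right]
      have h2 : z⁻¹ ^ δ = ∏ i ∈ Finset.range δ, z⁻¹ := by simp
      rw [this, h2, ← Finset.prod_range_reflect (fun i => 1 + (q : ℂ) ^ i * y),
        ← Finset.prod_mul_distrib, ← Finset.prod_mul_distrib]
      refine Finset.prod_congr rfl fun i hi => ?_
      have hi' := Finset.mem_range.1 hi
      have e : (q : ℂ) ^ δ = q ^ (δ - 1 - i) * q * q ^ i := by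
        rw [← pow_succ, ← pow_add]; congr 1; omega
      rw [hy, inv_pow, e]
      field_simp
      ring
    · refine Finset.prod_congr rfl fun i _ => ?_
      rw [hy, pow_add, inv_pow, pow_succ]
      field_simp
      ring
  rw [hprod, prod_one_add_pow_mul hq, Finset.mul_sum]
  refine Finset.sum_bij' (fun (k : ℕ) _ => (k : ℤ) - δ) (fun m _ => (m + δ).toNat)
    ?_ ?_ ?_ ?_ ?_
  · intro k hk; simp at hk ⊢; omega
  · intro m hm; simp at hm ⊢; omega
  · intro k hk; simp
  · intro m hm; simp at hm ⊢; omega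
  · intro k hk
    have e1 : (δ : ℤ) + ((k : ℤ) - δ) = k := by ring
    have e2 : (γ : ℤ) - ((k : ℤ) - δ) = ((δ + γ : ℕ) : ℤ) - k := by push_cast; ring
    have e3 : q ^ (((k : ℤ) - δ) * ((k : ℤ) - δ + 1) / 2) =
        q ^ (δ.choose 2) * q ^ (k.choose 2) * (q * q⁻¹ ^ δ) ^ k := by
      rw [zpow_triangle hq0, Nat.choose_succ_succ' k 1, Nat.choose_one_right, pow_add, mul_pow,
        pow_right_comm q⁻¹]
      ring
    rw [thetaCoeff, e1, e2, ← gauss, e3, hy, zpow_sub₀ hz, zpow_natCast, zpow_natCast, inv_pow]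
    push_cast
    rw [mul_pow, mul_pow, mul_pow]
    field_simp

theorem thetaCoeff_of_notMem {q : ℝ} {γ δ : ℕ} {m : ℤ}
    (h : m ∉ Finset.Icc (-(δ : ℤ)) (γ : ℤ)) : thetaCoeff q γ δ m = 0 := by
  rw [Finset.mem_Icc, not_and_or] at h
  rcases h with h | h
  · rw [thetaCoeff, qPochInv_of_neg q (m := δ + m) (by omega)]; ring
  · rw [thetaCoeff, qPochInv_of_neg q (m := γ - m) (by omega)]; ring

theorem thetaCoeff_eq_qBinom {q : ℝ} (hq : |q| ≠ 1) {γ δ : ℕ} {m : ℤ}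
    (h : m ∈ Finset.Icc (-(δ : ℤ)) (γ : ℤ)) : thetaCoeff q γ δ m =
      qBinom q ((δ : ℤ) + γ) ((δ : ℤ) + m).toNat * q ^ (m * (m + 1) / 2) := by
  rw [Finset.mem_Icc] at h
  obtain ⟨k, hk⟩ : ∃ k : ℕ, (δ : ℤ) + m = k := ⟨((δ : ℤ) + m).toNat, by omega⟩
  have e : (γ : ℤ) - m = ((δ + γ : ℕ) : ℤ) - k := by omega
  have := qBinom_natCast hq (n := δ + γ) (r := k) (by omega)
  push_cast at this
  rw [thetaCoeff, hk, Int.toNat_natCast, this, gauss, e]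

theorem circleMean_congr {f g : ℂ → ℂ} (h : ∀ z, z ≠ 0 → f z = g z) :
    circleMean f = circleMean g := by
  rw [circleMean, circleMean]
  congr 2
  funext θ
  exact h _ (Complex.exp_ne_zero _)

theorem circleMean_zpow (m : ℤ) : circleMean (fun z => z ^ m) = if m = 0 then 1 else 0 := by
  have hpi : (Real.pi : ℂ) ≠ 0 := by exact_mod_cast Real.pi_ne_zero
  rw [circleMean]
  split_ifs with h
  · subst h
    simp only [zpow_zero, intervalIntegral.integral_const, sub_zero, Complex.real_smul, mul_one]
    push_cast
    exact inv_mul_cancel₀ (mul_ne_zero two_ne_zero hpi)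
  · have hm : ((m : ℂ) * Complex.I) ≠ 0 :=
      mul_ne_zero (by exact_mod_cast h) Complex.I_ne_zero
    have e : ∀ θ : ℝ, Complex.exp (Complex.I * θ) ^ m = Complex.exp ((m : ℂ) * Complex.I * θ) := by
      intro θ
      rw [← Complex.exp_int_mul, mul_assoc]
    simp only [e]
    rw [integral_exp_mul_complex hm]
    have : (m : ℂ) * Complex.I * ((2 * Real.pi : ℝ) : ℂ) = m * (2 * Real.pi * Complex.I) := by
      push_cast; ring
    rw [this, Complex.exp_int_mul_two_pi_mul_I]
    simp

theorem continuous_zpow_exp (m : ℤ) :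
    Continuous fun θ : ℝ => Complex.exp (Complex.I * θ) ^ m :=
  Continuous.zpow₀ (by fun_prop) m fun θ => Or.inl (Complex.exp_ne_zero _)

theorem circleMean_sum_zpow {ι : Type*} (s : Finset ι) (c : ι → ℂ) (e : ι → ℤ) :
    circleMean (fun z => ∑ i ∈ s, c i * z ^ e i) = ∑ i ∈ s, if e i = 0 then c i else 0 := by
  rw [circleMean, intervalIntegral.integral_finsetSum fun i _ =>
    ((continuous_zpow_exp (e i)).const_mul (c i)).intervalIntegrable _ _, Finset.mul_sum]
  refine Finset.sum_congr rfl fun i _ => ?_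
  rw [intervalIntegral.integral_const_mul, mul_left_comm]
  have := circleMean_zpow (e i)
  rw [circleMean] at this
  rw [this, mul_ite, mul_one, mul_zero]

theorem circleMean_sum_mul_thetaSymbol {q : ℝ} (hq0 : q ≠ 0) (hq : |q| ≠ 1) (γ δ : ℕ)
    {ι : Type*} (s : Finset ι) (c : ι → ℂ) (e : ι → ℤ) :
    circleMean (fun z => (∑ i ∈ s, c i * z ^ (-e i)) * thetaSymbol q γ δ z) =
      ∑ i ∈ s, c i * thetaCoeff q γ δ (e i) := by
  have h : ∀ z : ℂ, z ≠ 0 → (∑ i ∈ s, c i * z ^ (-e i)) * thetaSymbol q γ δ z =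
      ∑ p ∈ s ×ˢ Finset.Icc (-(δ : ℤ)) (γ : ℤ),
        (c p.1 * thetaCoeff q γ δ p.2) * z ^ (p.2 - e p.1) := by
    intro z hz
    rw [thetaSymbol_eq_sum hq0 hq γ δ hz, Finset.sum_mul_sum, ← Finset.sum_product']
    refine Finset.sum_congr rfl fun p _ => ?_
    rw [sub_eq_add_neg, zpow_add₀ hz]
    ring
  rw [circleMean_congr h, circleMean_sum_zpow, Finset.sum_product]
  refine Finset.sum_congr rfl fun i _ => ?_
  simp only [sub_eq_zero]
  rw [Finset.sum_ite_eq']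
  split_ifs with hi
  · rfl
  · rw [thetaCoeff_of_notMem hi]; simp

theorem toeplitz_thetaSymbol {q : ℝ} (hq0 : q ≠ 0) (hq : |q| ≠ 1) (γ δ N : ℕ) :
    toeplitz (thetaSymbol q γ δ) N = (thetaToeplitz q γ δ N).map Complex.ofRealHom := by
  ext a b
  have := circleMean_sum_mul_thetaSymbol hq0 hq γ δ (Finset.univ : Finset Unit) (fun _ => 1)
    fun _ => (a : ℤ) - b
  simp only [Finset.univ_unique, Finset.sum_singleton, one_mul] at this
  rw [toeplitz, Matrix.of_apply, Matrix.map_apply, thetaToeplitz, Matrix.of_apply]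
  simp only [mul_comm (thetaSymbol q γ δ _)]
  exact this

theorem det_toeplitz {q : ℝ} (hq0 : q ≠ 0) (hq : |q| ≠ 1) (γ δ N : ℕ) :
    (toeplitz (thetaSymbol q γ δ) N).det = ((thetaToeplitz q γ δ N).det : ℂ) := by
  rw [toeplitz_thetaSymbol hq0 hq]
  exact (RingHom.map_det Complex.ofRealHom _).symm

theorem toeplitz_inv {q : ℝ} (hq0 : q ≠ 0) (hq : |q| ≠ 1) (γ δ N : ℕ) (a b : Fin (N + 1)) :
    (toeplitz (thetaSymbol q γ δ) (N + 1))⁻¹ a b = (thetaInv q γ δ N a b : ℂ) := by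
  have h : thetaToeplitz q γ δ (N + 1) *
      (Matrix.of fun a b : Fin (N + 1) => thetaInv q γ δ N a b) = 1 := by
    rw [← thetaToeplitz_inv hq0 hq]
    exact Matrix.mul_nonsing_inv _ (det_thetaToeplitz_ne_zero hq0 hq _ _ _).isUnit
  have h2 := congrArg (fun A => A.map Complex.ofRealHom) h
  simp only [Matrix.map_mul, Matrix.map_one _ (map_zero Complex.ofRealHom)
    (map_one Complex.ofRealHom)] at h2
  rw [toeplitz_thetaSymbol hq0 hq, Matrix.inv_eq_right_inv h2]
  rfl

/-! ### The normalized biorthogonal polynomials. -/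

theorem biorthNorm_sq (q : ℝ) (γ δ n : ℕ) :
    biorthNorm q γ δ n * biorthNorm q γ δ n = ((biorthSq q γ δ n)⁻¹ : ℝ) := by
  -- Squaring undoes the principal root whatever the sign of the radicand, which can be negative for
  -- q < -1.
  rw [biorthNorm, ← pow_two, ← Complex.cpow_nat_mul, biorthSq, inv_div]
  norm_num

theorem biorthNorm_ne_zero {q : ℝ} (hq : |q| ≠ 1) (γ δ n : ℕ) : biorthNorm q γ δ n ≠ 0 := by
  intro h
  have h1 := biorthNorm_sq q γ δ n
  rw [h, zero_mul] at h1
  exact inv_ne_zero (biorthSq_ne_zero hq γ δ n) (by exact_mod_cast h1.symm)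

/-- With δ + 1 the truncated subtractions in `biorthP` are genuine ones. -/
theorem biorthP_eq {q : ℝ} (hq : |q| ≠ 1) (γ δ n : ℕ) :
    biorthP q γ (δ + 1) n = ∑ r ∈ Finset.range (n + 1), Polynomial.monomial r
      (biorthNorm q γ (δ + 1) n * (pCoeff q γ (δ + 1) n r : ℂ)) := by
  refine Finset.sum_congr rfl fun r hr => ?_
  have hr' := Nat.lt_succ_iff.1 (Finset.mem_range.1 hr)
  have e : δ + 1 + n - r - 1 = δ + (n - r) := by omega
  rw [pCoeff, prod_one_sub_pow_add hq, qBinom_natCast hq hr', e, Nat.add_sub_cancel]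

theorem biorthQ_eq {q : ℝ} (hq : |q| ≠ 1) (γ δ n : ℕ) :
    biorthQ q (γ + 1) δ n = ∑ r ∈ Finset.range (n + 1), Polynomial.monomial r
      (biorthNorm q (γ + 1) δ n * (qCoeff q (γ + 1) δ n r : ℂ)) := by
  refine Finset.sum_congr rfl fun r hr => ?_
  have hr' := Nat.lt_succ_iff.1 (Finset.mem_range.1 hr)
  have e : γ + 1 + n - r - 1 = γ + (n - r) := by omega
  rw [qCoeff, pCoeff, prod_one_sub_pow_add hq, qBinom_natCast hq hr', e, Nat.add_sub_cancel]
  congr 3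
  ring

theorem natDegree_sum_monomial {n : ℕ} {c : ℕ → ℂ} (h : c n ≠ 0) :
    (∑ r ∈ Finset.range (n + 1), Polynomial.monomial r (c r)).natDegree = n := by
  refine Polynomial.natDegree_eq_of_le_of_coeff_ne_zero ?_ ?_
  · exact Polynomial.natDegree_sum_le_of_forall_le _ _ fun r hr =>
      (Polynomial.natDegree_monomial_le _).trans (Nat.lt_succ_iff.1 (Finset.mem_range.1 hr))
  · simpa [Polynomial.finsetSum_coeff, Polynomial.coeff_monomial] using h

theorem natDegree_biorthP {q : ℝ} (hq : |q| ≠ 1) (γ δ n : ℕ) :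
    (biorthP q γ (δ + 1) n).natDegree = n := by
  rw [biorthP_eq hq]
  refine natDegree_sum_monomial (c := fun r => _ * (pCoeff q γ (δ + 1) n r : ℂ)) ?_
  simp [pCoeff_self hq, biorthNorm_ne_zero hq]

theorem natDegree_biorthQ {q : ℝ} (hq : |q| ≠ 1) (γ δ n : ℕ) :
    (biorthQ q (γ + 1) δ n).natDegree = n := by
  rw [biorthQ_eq hq]
  refine natDegree_sum_monomial (c := fun r => _ * (qCoeff q (γ + 1) δ n r : ℂ)) ?_
  simp [qCoeff_self hq, biorthNorm_ne_zero hq]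

theorem circleMean_biorth {q : ℝ} (hq0 : q ≠ 0) (hq : |q| ≠ 1) (γ δ m n : ℕ) :
    circleMean (fun z => (biorthP q (γ + 1) (δ + 1) m).eval z *
      (biorthQ q (γ + 1) (δ + 1) n).eval z⁻¹ * thetaSymbol q (γ + 1) (δ + 1) z) =
        if m = n then 1 else 0 := by
  have h : ∀ z : ℂ, z ≠ 0 → (biorthP q (γ + 1) (δ + 1) m).eval z *
      (biorthQ q (γ + 1) (δ + 1) n).eval z⁻¹ * thetaSymbol q (γ + 1) (δ + 1) z =
      (∑ p ∈ Finset.range (n + 1) ×ˢ Finset.range (m + 1),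
        (biorthNorm q (γ + 1) (δ + 1) m * biorthNorm q (γ + 1) (δ + 1) n *
          (qCoeff q (γ + 1) (δ + 1) n p.1 * pCoeff q (γ + 1) (δ + 1) m p.2)) *
            z ^ (-((p.1 : ℤ) - p.2))) * thetaSymbol q (γ + 1) (δ + 1) z := by
    intro z hz
    rw [biorthP_eq hq, biorthQ_eq hq, Polynomial.eval_finsetSum, Polynomial.eval_finsetSum,
      mul_comm (Finset.sum _ _), Finset.sum_mul_sum, ← Finset.sum_product']
    congr 1
    refine Finset.sum_congr rfl fun p _ => ?_
    rw [Polynomial.eval_monomial, Polynomial.eval_monomial, neg_sub, zpow_sub₀ hz, zpow_natCast,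
      zpow_natCast, inv_pow]
    ring
  rw [circleMean_congr h, circleMean_sum_mul_thetaSymbol hq0 hq _ _ _
    (fun p : ℕ × ℕ => biorthNorm q (γ + 1) (δ + 1) m * biorthNorm q (γ + 1) (δ + 1) n *
          (qCoeff q (γ + 1) (δ + 1) n p.1 * pCoeff q (γ + 1) (δ + 1) m p.2 : ℂ))
    (fun p => (p.1 : ℤ) - p.2)]
  have key := sum_qCoeff_thetaCoeff_pCoeff hq0 hq (γ + 1) (δ + 1) m n
  rw [← Finset.sum_product'] at key
  have e : ∑ p ∈ Finset.range (n + 1) ×ˢ Finset.range (m + 1),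
      biorthNorm q (γ + 1) (δ + 1) m * biorthNorm q (γ + 1) (δ + 1) n *
          (qCoeff q (γ + 1) (δ + 1) n p.1 * pCoeff q (γ + 1) (δ + 1) m p.2 : ℂ) *
            thetaCoeff q (γ + 1) (δ + 1) ((p.1 : ℤ) - p.2) =
      biorthNorm q (γ + 1) (δ + 1) m * biorthNorm q (γ + 1) (δ + 1) n *
        ((if m = n then biorthSq q (γ + 1) (δ + 1) n else 0 : ℝ) : ℂ) := by
    rw [← key, Complex.ofReal_sum, Finset.mul_sum]
    refine Finset.sum_congr rfl fun p _ => ?_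
    push_cast
    ring
  rw [e]
  split_ifs with hmn
  · rw [hmn, biorthNorm_sq, ← Complex.ofReal_mul, inv_mul_cancel₀ (biorthSq_ne_zero hq _ _ _),
      Complex.ofReal_one]
  · simp

/-! ### Generating function of the complete homogeneous polynomials. -/

theorem eval_hsymm {α : Type*} [Fintype α] [DecidableEq α] (x : α → ℝ) (n : ℕ) :
    MvPolynomial.eval x (MvPolynomial.hsymm α ℝ n) = ∑ s : Sym α n, (s.1.map x).prod := by
  rw [MvPolynomial.hsymm, map_sum]
  refine Finset.sum_congr rfl fun s _ => ?_
  rw [map_multiset_prod, Multiset.map_map]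
  simp

/-- Multisets split by whether they contain `none`; removing one copy of it gives the first term. -/
theorem eval_hsymm_option {α : Type*} [Fintype α] [DecidableEq α] (x : Option α → ℝ) (n : ℕ) :
    MvPolynomial.eval x (MvPolynomial.hsymm (Option α) ℝ (n + 1)) =
      x none * MvPolynomial.eval x (MvPolynomial.hsymm (Option α) ℝ n) +
        MvPolynomial.eval (fun a => x (some a)) (MvPolynomial.hsymm α ℝ (n + 1)) := by
  rw [eval_hsymm, eval_hsymm, eval_hsymm, ← (symOptionSuccEquiv (α := α) (n := n)).symm.sum_comp,
    Fintype.sum_sum_type, Finset.mul_sum]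
  congr 1
  · refine Finset.sum_congr rfl fun s _ => ?_
    change (Multiset.map x ↑(none ::ₛ s)).prod = _
    rw [Sym.coe_cons, Multiset.map_cons, Multiset.prod_cons]
    rfl
  · refine Finset.sum_congr rfl fun s _ => ?_
    simp [symOptionSuccEquiv]

theorem eval_hsymm_fin_succ (x : ℕ → ℝ) (M n : ℕ) :
    MvPolynomial.eval (fun i : Fin (M + 1) => x i) (MvPolynomial.hsymm (Fin (M + 1)) ℝ (n + 1)) =
      x M * MvPolynomial.eval (fun i : Fin (M + 1) => x i) (MvPolynomial.hsymm (Fin (M + 1)) ℝ n) +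
        MvPolynomial.eval (fun i : Fin M => x i) (MvPolynomial.hsymm (Fin M) ℝ (n + 1)) := by
  have e : ∀ k, MvPolynomial.eval (fun i : Fin (M + 1) => x i)
      (MvPolynomial.hsymm (Fin (M + 1)) ℝ k) =
      MvPolynomial.eval (fun o : Option (Fin M) => x (finSuccEquivLast.symm o))
        (MvPolynomial.hsymm (Option (Fin M)) ℝ k) := by
    intro k
    rw [← MvPolynomial.rename_hsymm _ ℝ k (finSuccEquivLast (n := M)), MvPolynomial.eval_rename]
    congr 2
    funext i
    simp
  rw [e, e, eval_hsymm_option]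
  simp

/-- The generating function of the complete homogeneous polynomials at `x_0, …, x_{M-1}`. -/
def hSeries (x : ℕ → ℝ) (M : ℕ) : PowerSeries ℝ :=
  PowerSeries.mk fun n => MvPolynomial.eval (fun i : Fin M => x i) (MvPolynomial.hsymm (Fin M) ℝ n)

/-- The recursion in the number of variables says (1 - x_M X) H_{M+1} = H_M. -/
theorem prod_mul_hSeries (x : ℕ → ℝ) (M : ℕ) :
    (∏ i ∈ Finset.range M, (1 - PowerSeries.C (x i) * PowerSeries.X)) * hSeries x M = 1 := by
  induction M with
  | zero =>
    ext n
    rcases n with _ | n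
    · simp [hSeries]
    · simp [hSeries, eval_hsymm]
  | succ M ih =>
    rw [Finset.prod_range_succ, mul_assoc]
    refine Eq.trans ?_ ih
    congr 1
    ext n
    rcases n with _ | n
    · simp [hSeries]
    · rw [sub_mul, one_mul, mul_assoc, map_sub, PowerSeries.coeff_C_mul,
        PowerSeries.coeff_succ_X_mul]
      simp only [hSeries, PowerSeries.coeff_mk]
      rw [eval_hsymm_fin_succ]
      ring

/-! ### Complementary minors of inverse Toeplitz matrices. -/

/-- The coefficients of a power series, extended by zero to negative indices. -/
def coeffInt (F : PowerSeries ℝ) (m : ℤ) : ℝ := if 0 ≤ m then PowerSeries.coeff m.toNat F else 0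

theorem coeffInt_natCast (F : PowerSeries ℝ) (n : ℕ) : coeffInt F n = PowerSeries.coeff n F := by
  simp [coeffInt]

theorem coeffInt_of_neg (F : PowerSeries ℝ) {m : ℤ} (h : m < 0) : coeffInt F m = 0 := by
  simp [coeffInt, not_le.2 h]

theorem sum_coeffInt_mul (F G : PowerSeries ℝ) {a n : ℕ} (b : ℕ) (ha : a < n) :
    ∑ c ∈ Finset.range n, coeffInt F ((a : ℤ) - c) * coeffInt G ((c : ℤ) - b) =
      coeffInt (F * G) ((a : ℤ) - b) := by
  rcases lt_or_ge a b with h | h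
  · rw [coeffInt_of_neg (F * G) (by omega)]
    refine Finset.sum_eq_zero fun c _ => ?_
    rcases lt_or_ge a c with h1 | h1
    · rw [coeffInt_of_neg F (by omega), zero_mul]
    · rw [coeffInt_of_neg G (by omega), mul_zero]
  · obtain ⟨l, rfl⟩ := Nat.exists_eq_add_of_le h
    have e : (((b + l : ℕ) : ℤ) - b) = l := by push_cast; ring
    rw [← Finset.sum_subset (Finset.range_subset_range.2 (show b + (l + 1) ≤ n by omega)),
      Finset.sum_range_add, Finset.sum_eq_zero, zero_add, e, coeffInt_natCast, mul_comm F,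
      PowerSeries.coeff_mul, Finset.Nat.sum_antidiagonal_eq_sum_range_succ_mk]
    · refine Finset.sum_congr rfl fun j hj => ?_
      have hj' := Finset.mem_range.1 hj
      have e1 : ((b + l : ℕ) : ℤ) - ((b + j : ℕ) : ℤ) = ((l - j : ℕ) : ℤ) := by omega
      have e2 : ((b + j : ℕ) : ℤ) - b = j := by omega
      rw [e1, e2, coeffInt_natCast, coeffInt_natCast, mul_comm]
    · intro c hc
      have := Finset.mem_range.1 hc
      rw [coeffInt_of_neg G (by omega), mul_zero]
    · intro c _ hc
      rw [Finset.mem_range, not_lt] at hc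
      rw [coeffInt_of_neg F (by omega), zero_mul]

/-- The sequences `e` and `h` are inverse to each other under convolution. -/
structure ConvInv (e h : ℤ → ℝ) : Prop where
  neg : ∀ m : ℤ, m < 0 → h m = 0
  zero : h 0 = 1
  conv : ∀ a b n : ℕ, a < n →
    ∑ c ∈ Finset.range n, e ((a : ℤ) - c) * h ((c : ℤ) - b) = if a = b then 1 else 0

/-- The Toeplitz matrix `(e_{d+a-b})`. -/
def shiftToeplitz (e : ℤ → ℝ) (d n : ℕ) : Matrix (Fin n) (Fin n) ℝ :=
  Matrix.of fun a b => e ((d : ℤ) + a - b)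

/-- The rows of index at least `N + 1` and columns of index below `d` of `(h_{a-b})`. -/
def hLowerLeft (h : ℤ → ℝ) (N d : ℕ) : Matrix (Fin d) (Fin d) ℝ :=
  Matrix.of fun a b => h ((N : ℤ) + 1 + a - b)

/-- The rows of index at least `N + 1` and columns of index at least `d` of `(h_{a-b})`. -/
def hLowerRight (h : ℤ → ℝ) (N d : ℕ) : Matrix (Fin d) (Fin (N + 1)) ℝ :=
  Matrix.of fun a b => h ((N : ℤ) + 1 + a - (d + b))

/-- The rows of index at most `N` and columns of index below `d` of `(h_{a-b})`. -/
def hUpperLeft (h : ℤ → ℝ) (N d : ℕ) : Matrix (Fin (N + 1)) (Fin d) ℝ :=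
  Matrix.of fun a b => h ((a : ℤ) - b)

/-- The rows of index at most `N` and columns of index at least `d` of `(h_{a-b})`. -/
def hUpperRight (h : ℤ → ℝ) (N d : ℕ) : Matrix (Fin (N + 1)) (Fin (N + 1)) ℝ :=
  Matrix.of fun a b => h ((a : ℤ) - (d + b))

/-- The rows of index at least `d` and columns of index at least `N + 1` of `(e_{a-b})`. -/
def eLowerRight (e : ℤ → ℝ) (N d : ℕ) : Matrix (Fin (N + 1)) (Fin d) ℝ :=
  Matrix.of fun a b => e ((d : ℤ) + a - (N + 1 + b))

namespace ConvInv

variable {e h : ℤ → ℝ}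

/-- The block of (e_{a-b})(h_{a-b}) = 1 in rows of index at least d and columns of index below d,
with the inner sum split at N + 1. `shiftToeplitz_mul_right` is the block with columns of index at
least d. -/
theorem shiftToeplitz_mul_left (H : ConvInv e h) (N d : ℕ) :
    shiftToeplitz e d (N + 1) * hUpperLeft h N d + eLowerRight e N d * hLowerLeft h N d = 0 := by
  ext a b
  have := H.conv (d + a) b (N + 1 + d) (by omega)
  rw [if_neg (by omega), Finset.sum_range_add, ← Fin.sum_univ_eq_sum_range
    (fun c => e (((d + a : ℕ) : ℤ) - c) * h ((c : ℤ) - b)), ← Fin.sum_univ_eq_sum_range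
    (fun c => e (((d + a : ℕ) : ℤ) - ((N + 1 + c : ℕ) : ℤ)) * h (((N + 1 + c : ℕ) : ℤ) - b))]
    at this
  push_cast at this
  simpa [Matrix.mul_apply, shiftToeplitz, hUpperLeft, eLowerRight, hLowerLeft] using this

theorem shiftToeplitz_mul_right (H : ConvInv e h) (N d : ℕ) :
    shiftToeplitz e d (N + 1) * hUpperRight h N d + eLowerRight e N d * hLowerRight h N d = 1 := by
  ext a b
  have := H.conv (d + a) (d + b) (N + 1 + d) (by omega)
  have hab : (d + (a : ℕ) = d + b) = (a = b) := by simp [Fin.ext_iff]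
  rw [Finset.sum_range_add, ← Fin.sum_univ_eq_sum_range
    (fun c => e (((d + a : ℕ) : ℤ) - c) * h ((c : ℤ) - ((d + b : ℕ) : ℤ))),
    ← Fin.sum_univ_eq_sum_range (fun c => e (((d + a : ℕ) : ℤ) - ((N + 1 + c : ℕ) : ℤ)) *
      h (((N + 1 + c : ℕ) : ℤ) - ((d + b : ℕ) : ℤ)))] at this
  simp only [hab] at this
  push_cast at this
  simpa [Matrix.mul_apply, shiftToeplitz, hUpperRight, eLowerRight, hLowerRight,
    Matrix.one_apply] using this

theorem det_shiftToeplitz_mul (H : ConvInv e h) (N d : ℕ) :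
    (shiftToeplitz e d (N + 1)).det * (Matrix.fromBlocks (hLowerLeft h N d) (hLowerRight h N d)
      (hUpperLeft h N d) (hUpperRight h N d)).det = (hLowerLeft h N d).det := by
  have key : Matrix.fromBlocks 1 0 (eLowerRight e N d) (shiftToeplitz e d (N + 1)) *
      Matrix.fromBlocks (hLowerLeft h N d) (hLowerRight h N d) (hUpperLeft h N d)
        (hUpperRight h N d) =
      Matrix.fromBlocks (hLowerLeft h N d) (hLowerRight h N d) 0 1 := by
    rw [Matrix.fromBlocks_multiply, Matrix.zero_mul, Matrix.zero_mul, add_zero, add_zero,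
      Matrix.one_mul, Matrix.one_mul, add_comm (eLowerRight e N d * _), H.shiftToeplitz_mul_left,
      add_comm (eLowerRight e N d * _), H.shiftToeplitz_mul_right]
  have := congrArg Matrix.det key
  rw [Matrix.det_mul, Matrix.det_fromBlocks_zero₁₂, Matrix.det_fromBlocks_zero₂₁, Matrix.det_one,
    Matrix.det_one, one_mul, mul_one] at this
  exact this

/-- The Schur complement of the lower left h-block is T⁻¹. Row j is cleared with V = T⁻¹ ·
`eLowerRight`, so only T has to be invertible, not the h-block. -/
theorem det_minor (H : ConvInv e h) (N d : ℕ) (hT : IsUnit (shiftToeplitz e d (N + 1)).det)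
    (j k : Fin (N + 1)) :
    (Matrix.fromBlocks (hLowerLeft h N d) (Matrix.of fun a (_ : Unit) => hLowerRight h N d a k)
      (Matrix.of fun (_ : Unit) b => hUpperLeft h N d j b)
      (Matrix.of fun (_ : Unit) (_ : Unit) => hUpperRight h N d j k)).det =
      (hLowerLeft h N d).det * (shiftToeplitz e d (N + 1))⁻¹ j k := by
  set T := shiftToeplitz e d (N + 1)
  set V := T⁻¹ * eLowerRight e N d
  have h1 : hUpperLeft h N d + V * hLowerLeft h N d = 0 := by
    have h0 : T * hUpperLeft h N d + eLowerRight e N d * hLowerLeft h N d = 0 :=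
      H.shiftToeplitz_mul_left N d
    have := congrArg (fun A => T⁻¹ * A) h0
    simpa [V, Matrix.mul_add, ← Matrix.mul_assoc, Matrix.nonsing_inv_mul _ hT] using this
  have h2 : hUpperRight h N d + V * hLowerRight h N d = T⁻¹ := by
    have h0 : T * hUpperRight h N d + eLowerRight e N d * hLowerRight h N d = 1 :=
      H.shiftToeplitz_mul_right N d
    have := congrArg (fun A => T⁻¹ * A) h0
    simpa [V, Matrix.mul_add, ← Matrix.mul_assoc, Matrix.nonsing_inv_mul _ hT] using this
  have key : Matrix.fromBlocks 1 0 (Matrix.of fun (_ : Unit) b => V j b) 1 *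
      Matrix.fromBlocks (hLowerLeft h N d) (Matrix.of fun a (_ : Unit) => hLowerRight h N d a k)
      (Matrix.of fun (_ : Unit) b => hUpperLeft h N d j b)
      (Matrix.of fun (_ : Unit) (_ : Unit) => hUpperRight h N d j k) =
      Matrix.fromBlocks (hLowerLeft h N d) (Matrix.of fun a (_ : Unit) => hLowerRight h N d a k)
        0 (Matrix.of fun (_ : Unit) (_ : Unit) => T⁻¹ j k) := by
    rw [Matrix.fromBlocks_multiply, Matrix.zero_mul, Matrix.zero_mul, add_zero, add_zero,
      Matrix.one_mul, Matrix.one_mul, Matrix.one_mul, Matrix.one_mul]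
    congr 1
    · ext u b
      have := congrFun (congrFun h1 j) b
      rw [add_comm] at this
      simpa [Matrix.mul_apply] using this
    · ext u v
      have := congrFun (congrFun h2 j) k
      rw [add_comm] at this
      simpa [Matrix.mul_apply] using this
  have := congrArg Matrix.det key
  rw [Matrix.det_mul, Matrix.det_fromBlocks_zero₁₂, Matrix.det_fromBlocks_zero₂₁, Matrix.det_one,
    Matrix.det_one, one_mul, one_mul] at this
  rw [this]
  simp

end ConvInv

theorem finRotate_pow_val (n m : ℕ) (i : Fin (n + 1)) :
    (((finRotate (n + 1)) ^ m) i : ℕ) = (i + m) % (n + 1) := by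
  induction m with
  | zero => simp [Nat.mod_eq_of_lt i.2]
  | succ m ih =>
    rw [pow_succ', Equiv.Perm.mul_apply, finRotate_apply, Fin.val_add, ih, Fin.val_one',
      ← Nat.add_mod, add_assoc]

theorem sign_finRotate_pow (d N : ℕ) :
    ((Equiv.Perm.sign ((finRotate (d + N + 1)) ^ (N + 1)) : ℤˣ) : ℤ) = (-1) ^ (d * (N + 1)) := by
  -- The exponent is (d + N)(N + 1), and N(N + 1) is even.
  rw [map_pow, sign_finRotate, Nat.add_sub_cancel, ← pow_mul, add_mul, pow_add,
    Even.neg_one_pow (Nat.even_mul_succ_self N), mul_one]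
  simp

namespace ConvInv

variable {e h : ℤ → ℝ}

/-- The block matrix is the unit lower triangular (h_{a-b}) with its last d rows moved to the top, a
cyclic rotation of rows. -/
theorem det_fromBlocks (H : ConvInv e h) (N d : ℕ) :
    (Matrix.fromBlocks (hLowerLeft h N d) (hLowerRight h N d)
      (hUpperLeft h N d) (hUpperRight h N d)).det = (-1) ^ (d * (N + 1)) := by
  set L : Matrix (Fin (d + N + 1)) (Fin (d + N + 1)) ℝ := Matrix.of fun a b => h ((a : ℤ) - b)
    with hL
  have hdet : L.det = 1 := by
    have hl : L.IsLowerTriangular := fun a b hab => H.neg _ (by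
      have : (a : ℕ) < b := hab
      omega)
    rw [Matrix.det_of_isLowerTriangular _ hl]
    exact Finset.prod_eq_one fun a _ => by simp [hL, H.zero]
  have key : Matrix.fromBlocks (hLowerLeft h N d) (hLowerRight h N d)
      (hUpperLeft h N d) (hUpperRight h N d) =
      (L.submatrix ((finRotate (d + N + 1)) ^ (N + 1)) id).submatrix
        (finSumFinEquiv (m := d) (n := N + 1)) (finSumFinEquiv (m := d) (n := N + 1)) := by
    ext a b
    rw [Matrix.submatrix_apply, Matrix.submatrix_apply, hL, Matrix.of_apply, finRotate_pow_val]
    rcases a with a | a <;> rcases b with b | b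
    · have : ((a : ℕ) + (N + 1)) % (d + N + 1) = a + (N + 1) := Nat.mod_eq_of_lt (by omega)
      simp [hLowerLeft, this]
      congr 1; ring
    · have : ((a : ℕ) + (N + 1)) % (d + N + 1) = a + (N + 1) := Nat.mod_eq_of_lt (by omega)
      simp [hLowerRight, this]
      congr 1; ring
    · have : (d + (a : ℕ) + (N + 1)) % (d + N + 1) = a := by
        rw [show d + (a : ℕ) + (N + 1) = a + (d + N + 1) by ring, Nat.add_mod_right]
        exact Nat.mod_eq_of_lt (by omega)
      simp [hUpperLeft, this]
    · have : (d + (a : ℕ) + (N + 1)) % (d + N + 1) = a := by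
        rw [show d + (a : ℕ) + (N + 1) = a + (d + N + 1) by ring, Nat.add_mod_right]
        exact Nat.mod_eq_of_lt (by omega)
      simp [hUpperRight, this]
  rw [key, Matrix.det_submatrix_equiv_self, Matrix.det_permute, hdet, mul_one, sign_finRotate_pow]
  simp

theorem det_skew (H : ConvInv e h) (N d : ℕ) (hT : IsUnit (shiftToeplitz e d (N + 1)).det)
    (j k : Fin (N + 1)) {μ ν : ℕ → ℕ} (hμ : ∀ a < d, μ a = N) (hμd : μ d = j) (hν0 : ν 0 = k)
    (hν : ∀ b, b ≠ 0 → ν b = 0) :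
    (Matrix.of fun a b : Fin (d + 1) => h ((μ a : ℤ) - ν b - a + b)).det =
      (-1) ^ d * (-1) ^ (d * (N + 1)) * (shiftToeplitz e d (N + 1)).det *
        (shiftToeplitz e d (N + 1))⁻¹ j k := by
  set A : Matrix (Fin (d + 1)) (Fin (d + 1)) ℝ :=
    Matrix.of fun a b => h ((μ a : ℤ) - ν b - a + b) with hA
  -- Reversing the first d indices in rows and columns alike costs no sign. The extra rotation moves
  -- column 0, the one carrying k, to the end and costs (-1)^d.
  set ρ : Fin d ⊕ Unit ≃ Fin (d + 1) :=
    (Equiv.sumCongr Fin.revPerm (Equiv.ofUnique Unit (Fin 1))).trans finSumFinEquiv with hρ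
  have r1 : ∀ i : Fin d, (ρ (Sum.inl i) : ℕ) = d - (i + 1) := fun i => by simp [hρ]
  have r2 : (ρ (Sum.inr ()) : ℕ) = d := by simp [hρ]
  have c1 : ∀ i : Fin d, (finRotate (d + 1) (ρ (Sum.inl i)) : ℕ) = d - i := by
    intro i
    have := finRotate_pow_val d 1 (ρ (Sum.inl i))
    rw [pow_one, r1, Nat.mod_eq_of_lt (by omega)] at this
    omega
  have c2 : (finRotate (d + 1) (ρ (Sum.inr ())) : ℕ) = 0 := by
    have := finRotate_pow_val d 1 (ρ (Sum.inr ()))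
    rw [pow_one, r2, Nat.mod_self] at this
    exact this
  have key : Matrix.fromBlocks (hLowerLeft h N d)
      (Matrix.of fun a (_ : Unit) => hLowerRight h N d a k)
      (Matrix.of fun (_ : Unit) b => hUpperLeft h N d j b)
      (Matrix.of fun (_ : Unit) (_ : Unit) => hUpperRight h N d j k) =
      (A.submatrix id (finRotate (d + 1))).submatrix ρ ρ := by
    ext a b
    rw [Matrix.submatrix_apply, Matrix.submatrix_apply, hA, Matrix.of_apply, id_eq]
    rcases a with a | a <;> rcases b with b | b
    · rw [c1, r1, hμ _ (by omega), hν _ (by omega), Matrix.fromBlocks_apply₁₁, hLowerLeft,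
        Matrix.of_apply]
      congr 1; omega
    · rw [c2, r1, hμ _ (by omega), hν0, Matrix.fromBlocks_apply₁₂, Matrix.of_apply, hLowerRight,
        Matrix.of_apply]
      congr 1; omega
    · rw [c1, r2, hμd, hν _ (by omega), Matrix.fromBlocks_apply₂₁, Matrix.of_apply, hUpperLeft,
        Matrix.of_apply]
      congr 1; omega
    · rw [c2, r2, hμd, hν0, Matrix.fromBlocks_apply₂₂, Matrix.of_apply, hUpperRight,
        Matrix.of_apply]
      congr 1; omega
  have h1 := H.det_minor N d hT j k
  rw [key, Matrix.det_submatrix_equiv_self, Matrix.det_permute', sign_finRotate,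
    ← H.det_shiftToeplitz_mul, H.det_fromBlocks, Nat.add_sub_cancel] at h1
  have s : (-1 : ℝ) ^ d * (-1) ^ d = 1 := by rw [← mul_pow]; simp
  push_cast at h1
  linear_combination (-1) ^ d * h1 - A.det * s

end ConvInv

/-! ### The skew Schur specialization through the symbol. -/

theorem shiftToeplitz_eq_smul {e t : ℤ → ℝ} {d : ℕ} {c u : ℝ} (hu : u ≠ 0)
    (het : ∀ m : ℤ, e (d + m) = c * u ^ m * t m) (n : ℕ) :
    shiftToeplitz e d n = c • (Matrix.diagonal (fun a : Fin n => u ^ (a : ℕ)) *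
      (Matrix.of fun a b : Fin n => t ((a : ℤ) - b)) *
        Matrix.diagonal fun a : Fin n => (u ^ (a : ℕ))⁻¹) := by
  ext a b
  rw [Matrix.smul_apply, Matrix.mul_diagonal, Matrix.diagonal_mul, shiftToeplitz, Matrix.of_apply,
    Matrix.of_apply, add_sub_assoc, het, zpow_sub₀ hu, zpow_natCast, zpow_natCast, smul_eq_mul]
  ring

theorem det_shiftToeplitz_eq {e t : ℤ → ℝ} {d : ℕ} {c u : ℝ} (hu : u ≠ 0)
    (het : ∀ m : ℤ, e (d + m) = c * u ^ m * t m) (n : ℕ) :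
    (shiftToeplitz e d n).det = c ^ n * (Matrix.of fun a b : Fin n => t ((a : ℤ) - b)).det := by
  rw [shiftToeplitz_eq_smul hu het, Matrix.det_smul, Matrix.det_mul, Matrix.det_mul,
    Matrix.det_diagonal, Matrix.det_diagonal, Fintype.card_fin, Finset.prod_inv_distrib]
  have : ∏ a : Fin n, u ^ (a : ℕ) ≠ 0 := Finset.prod_ne_zero_iff.2 fun a _ => pow_ne_zero _ hu
  field_simp

theorem shiftToeplitz_inv_apply {e t : ℤ → ℝ} {d : ℕ} {c u : ℝ} (hc : c ≠ 0) (hu : u ≠ 0)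
    (het : ∀ m : ℤ, e (d + m) = c * u ^ m * t m) (n : ℕ)
    (ht : IsUnit (Matrix.of fun a b : Fin n => t ((a : ℤ) - b)).det) (j k : Fin n) :
    (shiftToeplitz e d n)⁻¹ j k =
      c⁻¹ * u ^ ((j : ℤ) - k) * (Matrix.of fun a b : Fin n => t ((a : ℤ) - b))⁻¹ j k := by
  set T := Matrix.of fun a b : Fin n => t ((a : ℤ) - b) with hT
  have hD : Matrix.diagonal (fun a : Fin n => (u ^ (a : ℕ))⁻¹) *
      Matrix.diagonal (fun a : Fin n => u ^ (a : ℕ)) = 1 := by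
    rw [Matrix.diagonal_mul_diagonal, ← Matrix.diagonal_one]
    congr 1
    funext a
    exact inv_mul_cancel₀ (pow_ne_zero _ hu)
  have hinv : shiftToeplitz e d n * (c⁻¹ • (Matrix.diagonal (fun a : Fin n => u ^ (a : ℕ)) *
      T⁻¹ * Matrix.diagonal fun a : Fin n => (u ^ (a : ℕ))⁻¹)) = 1 := by
    rw [shiftToeplitz_eq_smul hu het, ← hT, Matrix.smul_mul, Matrix.mul_smul, smul_smul,
      mul_inv_cancel₀ hc, one_smul, Matrix.mul_assoc _ T⁻¹, Matrix.mul_assoc _ _ (_ * _),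
      ← Matrix.mul_assoc _ _ (T⁻¹ * _), hD, Matrix.one_mul, Matrix.mul_assoc, ← Matrix.mul_assoc T,
      Matrix.mul_nonsing_inv _ ht, Matrix.one_mul, mul_eq_one_comm.1 hD]
  rw [Matrix.inv_eq_right_inv hinv, Matrix.smul_apply, Matrix.mul_diagonal, Matrix.diagonal_mul,
    zpow_sub₀ hu, zpow_natCast, zpow_natCast, smul_eq_mul]
  ring

/-- The power series `∏ (1 - q^i X)`. -/
def eSeries (q : ℝ) (M : ℕ) : PowerSeries ℝ :=
  ∏ i ∈ Finset.range M, (1 - PowerSeries.C (q ^ i) * PowerSeries.X)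

theorem convInv_series (q : ℝ) (M : ℕ) :
    ConvInv (coeffInt (eSeries q M)) (coeffInt (hSeries (fun i => q ^ i) M)) where
  neg m hm := coeffInt_of_neg _ hm
  zero := by simp [coeffInt, hSeries]
  conv a b n ha := by
    rw [sum_coeffInt_mul _ _ b ha, eSeries, prod_mul_hSeries (fun i => q ^ i)]
    rcases lt_trichotomy a b with h | rfl | h
    · rw [coeffInt_of_neg _ (by omega), if_neg h.ne]
    · simp [coeffInt]
    · rw [if_neg h.ne', ← Nat.cast_sub h.le, coeffInt_natCast, PowerSeries.coeff_one,
        if_neg (by omega)]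

theorem coeff_eSeries {q : ℝ} (hq : |q| ≠ 1) (M k : ℕ) :
    PowerSeries.coeff k (eSeries q M) = (-1) ^ k * gauss q M k * q ^ (k.choose 2) := by
  have h := congrArg (Polynomial.coeToPowerSeries.ringHom (R := ℝ)) (prod_one_sub_C_pow_mul_X hq M)
  have e : Polynomial.coeToPowerSeries.ringHom (R := ℝ)
      (∏ i ∈ Finset.range M, (1 - Polynomial.C (q ^ i) * Polynomial.X)) = eSeries q M := by
    simp [eSeries, map_prod]
  rw [← e, h, Polynomial.coeToPowerSeries.ringHom_apply, Polynomial.coeff_coe,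
    Polynomial.finsetSum_coeff]
  simp only [Polynomial.coeff_C_mul_X_pow]
  rw [Finset.sum_ite_eq]
  split_ifs with hk
  · rfl
  · rw [gauss_of_lt q (by simpa using hk)]; ring

/-- Matches the two Toeplitz matrices for γ = M - d and δ = d, through C(d + m, 2) = C(d, 2) + (d -
1) m + m(m + 1)/2. -/
theorem coeffInt_eSeries {q : ℝ} (hq0 : q ≠ 0) (hq : |q| ≠ 1) {d M : ℕ} (hd : 1 ≤ d) (hM : d ≤ M)
    (m : ℤ) : coeffInt (eSeries q M) (d + m) =
      ((-1) ^ d * q ^ (d.choose 2)) * (-q ^ (d - 1)) ^ m * thetaCoeff q (M - d) d m := by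
  rcases lt_or_ge ((d : ℤ) + m) 0 with h | h
  · rw [coeffInt_of_neg _ h, thetaCoeff, qPochInv_of_neg q h]; ring
  · obtain ⟨k, hk⟩ : ∃ k : ℕ, (d : ℤ) + m = k := ⟨((d : ℤ) + m).toNat, by omega⟩
    have e1 : ((M - d : ℕ) : ℤ) - m = (M : ℤ) - k := by omega
    have e2 : m = (k : ℤ) - d := by omega
    have e3 : (-1 : ℝ) ^ k = (-1) ^ d * (-1) ^ m := by
      rw [← zpow_natCast, ← zpow_natCast, ← zpow_add₀ (by norm_num), hk]
    have e4 : q ^ (k.choose 2) =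
        q ^ (d.choose 2) * (q ^ (d - 1)) ^ m * q ^ (m * (m + 1) / 2) := by
      have h1 := two_mul_choose_two k
      have h2 := two_mul_choose_two d
      have h3 : m * (m + 1) / 2 = (k.choose 2 : ℕ) - (d.choose 2 : ℕ) - ((d - 1 : ℕ) : ℤ) * m := by
        refine Int.ediv_eq_of_eq_mul_left two_ne_zero ?_
        rw [e2]
        push_cast [hd]
        linarith
      rw [← zpow_natCast, ← zpow_natCast, ← zpow_natCast, ← zpow_mul, ← zpow_add₀ hq0,
        ← zpow_add₀ hq0, h3]
      congr 1
      ring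
    rw [thetaCoeff, hk, coeffInt_natCast, coeff_eSeries hq, e1, Nat.add_sub_cancel' hM, gauss, e3,
      e4, neg_eq_neg_one_mul (q ^ (d - 1)), mul_zpow]
    ring

theorem eval_hsymmInt (q : ℝ) (M : ℕ) (m : ℤ) :
    MvPolynomial.eval (fun i : Fin M => q ^ (i : ℕ)) (hsymmInt M m) =
      coeffInt (hSeries (fun i => q ^ i) M) m := by
  rw [hsymmInt, coeffInt]
  split_ifs
  · simp [hSeries]
  · simp

theorem skewSpec_eq_det (q : ℝ) (N d j k M : ℕ) :
    skewSpec q N d j k M = (Matrix.of fun a b : Fin (d + 1) =>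
      coeffInt (hSeries (fun i => q ^ i) M) (((List.replicate d N ++ [j]).getD a 0 : ℤ) -
        ([k].getD b 0 : ℕ) - a + b)).det := by
  have hlen : d + 1 = max (List.replicate d N ++ [j]).length [k].length := by simp
  rw [skewSpec, skewSchur, RingHom.map_det, ← Matrix.det_submatrix_equiv_self (finCongr hlen)]
  congr 1
  ext a b
  simp only [Matrix.submatrix_apply, RingHom.mapMatrix_apply, Matrix.map_apply, Matrix.of_apply,
    eval_hsymmInt, finCongr_apply, Fin.val_cast]

theorem skewSpec_eq_qFormula {q : ℝ} (hq0 : q ≠ 0) (hq : |q| ≠ 1) {N d j k M : ℕ} (hd : 1 ≤ d)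
    (hj : j ≤ N) (hk : k ≤ N) (hM : d ≤ M) : skewSpec q N d j k M = qFormula q N d j k M := by
  have hc : ((-1 : ℝ) ^ d * q ^ (d.choose 2)) ≠ 0 :=
    mul_ne_zero (pow_ne_zero _ (by norm_num)) (pow_ne_zero _ hq0)
  have hu : -q ^ (d - 1) ≠ 0 := neg_ne_zero.2 (pow_ne_zero _ hq0)
  have het := coeffInt_eSeries hq0 hq hd hM
  have hT0 := det_thetaToeplitz_ne_zero hq0 hq (M - d) d (N + 1)
  have hdet := det_shiftToeplitz_eq hu het (N + 1)
  have hinv := shiftToeplitz_inv_apply hc hu het (N + 1) hT0.isUnit ⟨j, by omega⟩ ⟨k, by omega⟩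
  have hunit : IsUnit (shiftToeplitz (coeffInt (eSeries q M)) d (N + 1)).det := by
    rw [hdet]
    exact (mul_ne_zero (pow_ne_zero _ hc) hT0).isUnit
  have hthis := (convInv_series q M).det_skew N d hunit ⟨j, by omega⟩ ⟨k, by omega⟩
    (μ := fun a => (List.replicate d N ++ [j]).getD a 0) (ν := fun b => [k].getD b 0)
    (fun a ha => by
      rw [List.getD_append _ _ _ _ (by simpa using ha), List.getD_replicate _ ha]) (by simp [List.getD]) (by simp)
    (fun b hb => by obtain ⟨b, rfl⟩ := Nat.exists_eq_succ_of_ne_zero hb; simp)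
  rw [skewSpec_eq_det, hthis, hdet, hinv]
  change _ * (_ * (thetaToeplitz q (M - d) d (N + 1)).det) *
    (_ * (thetaToeplitz q (M - d) d (N + 1))⁻¹ _ _) = _
  rw [thetaToeplitz_inv hq0 hq, det_thetaToeplitz hq0 hq, Matrix.of_apply, thetaInv, qFormula,
    Nat.add_sub_cancel' hM]
  have hterm : ∀ r ∈ Finset.Icc (max j k) N, (-1) ^ (j + k) * q ^ (r - k) *
      ((qGamma q (M - d + j + 1) * qGamma q (d + k + 1) * qGamma q (r + 1)) /
        (qGamma q (j + 1) * qGamma q (k + 1) * qGamma q (M + r + 1))) *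
      qBinom q (((M - d : ℕ) : ℤ) + r - k - 1) (r - k) * qBinom q ((d : ℤ) + r - j - 1) (r - j) =
      ((-1) ^ (j + k) * (q ^ k)⁻¹) * (q ^ r * ((qGamma q (M - d + j + 1) *
        qGamma q (d + k + 1) * qGamma q (r + 1)) / (qGamma q (j + 1) * qGamma q (k + 1) * qGamma q (M + r + 1))) *
      qBinom q ((M : ℤ) - d + r - k - 1) (r - k) * qBinom q ((d : ℤ) + r - j - 1) (r - j)) := by
    intro r hr
    have hkr : k ≤ r := le_trans (le_max_right _ _) (Finset.mem_Icc.1 hr).1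
    rw [Nat.cast_sub hM, pow_sub₀ q hq0 hkr]
    ring
  rw [Finset.sum_congr rfl hterm, ← Finset.mul_sum]
  generalize ∑ r ∈ Finset.Icc (max j k) N, (_ : ℝ) = S
  -- The signs cancel in pairs, c^{N+1} c⁻¹ leaves q^{C(d,2) N}, and the conjugation together with
  -- q^{-k} gives q^{(d-1)(j-k)-k}.
  have hs : (-1 : ℝ) ^ d * (-1) ^ (d * (N + 1)) * ((-1) ^ d * q ^ (d.choose 2)) ^ (N + 1) *
      (((-1) ^ d * q ^ (d.choose 2))⁻¹ * (-q ^ (d - 1)) ^ ((j : ℤ) - k)) *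
        ((-1) ^ (j + k) * (q ^ k)⁻¹) =
      q ^ (((d : ℤ) - 1) * j - d * k + (d : ℤ) * ((d : ℤ) - 1) * N / 2) := by
    have h1 : (d : ℤ) * ((d : ℤ) - 1) * N / 2 = ((d.choose 2 * N : ℕ) : ℤ) := by
      have := two_mul_choose_two d
      refine Int.ediv_eq_of_eq_mul_left two_ne_zero ?_
      push_cast
      linear_combination (-(N : ℤ)) * this
    have h2 : (-q ^ (d - 1)) ^ ((j : ℤ) - k) =
        (-1) ^ (j + k) * q ^ (((d : ℤ) - 1) * ((j : ℤ) - k)) := by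
      rw [neg_eq_neg_one_mul, mul_zpow, ← zpow_natCast q, ← zpow_mul, Nat.cast_sub hd, Nat.cast_one,
        ← zpow_natCast (-1 : ℝ) (j + k)]
      congr 1
      rw [show ((j + k : ℕ) : ℤ) = (j : ℤ) - k + 2 * k by push_cast; ring, zpow_add₀ (by norm_num),
        zpow_mul]
      norm_num
    have h3 : ((d : ℤ) - 1) * j - d * k + ((d.choose 2 * N : ℕ) : ℤ) =
        ((d.choose 2 * N : ℕ) : ℤ) + ((d : ℤ) - 1) * ((j : ℤ) - k) - (k : ℕ) := by ring
    have s1 : (-1 : ℝ) ^ d * (-1) ^ d = 1 := by rw [← mul_pow]; simp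
    have s2 : (-1 : ℝ) ^ (j + k) * (-1) ^ (j + k) = 1 := by rw [← mul_pow]; simp
    have s3 : (-1 : ℝ) ^ (d * (N + 1)) * (-1) ^ (d * (N + 1)) = 1 := by rw [← mul_pow]; simp
    have s4 : (((-1) ^ d * q ^ d.choose 2) : ℝ)⁻¹ = (-1) ^ d * (q ^ d.choose 2)⁻¹ := by
      rw [mul_inv, ← inv_pow, inv_neg_one]
    have s5 : q ^ d.choose 2 * (q ^ d.choose 2)⁻¹ = 1 := mul_inv_cancel₀ (pow_ne_zero _ hq0)
    rw [h1, h2, h3, zpow_sub₀ hq0, zpow_add₀ hq0, zpow_natCast, zpow_natCast, s4, mul_pow,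
      ← pow_mul, pow_mul q, pow_succ (q ^ d.choose 2) N]
    calc _ = ((-1 : ℝ) ^ d * (-1) ^ d) * ((-1) ^ (j + k) * (-1) ^ (j + k)) *
          ((-1 : ℝ) ^ (d * (N + 1)) * (-1) ^ (d * (N + 1))) *
          (q ^ d.choose 2 * (q ^ d.choose 2)⁻¹) * ((q ^ d.choose 2) ^ N *
            q ^ (((d : ℤ) - 1) * ((j : ℤ) - k)) * (q ^ k)⁻¹) := by ring
      _ = _ := by rw [s1, s2, s3, s5, div_eq_mul_inv]; ring
  rw [← hs]
  simp only [← add_assoc]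
  ring

/-! ### The limit q → 1. -/

theorem tendsto_qNum (n : ℕ) :
    Filter.Tendsto (fun q : ℝ => (1 - q ^ n) / (1 - q)) (𝓝[≠] 1) (𝓝 n) := by
  have h : Filter.Tendsto (fun q : ℝ => ∑ i ∈ Finset.range n, q ^ i) (𝓝[≠] 1) (𝓝 n) := by
    have hc : Continuous fun q : ℝ => ∑ i ∈ Finset.range n, q ^ i := by fun_prop
    have := (hc.tendsto 1).mono_left (nhdsWithin_le_nhds (s := {1}ᶜ))
    simpa using this
  refine h.congr' ?_
  filter_upwards [self_mem_nhdsWithin] with q hq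
  rw [eq_div_iff (sub_ne_zero.2 (Ne.symm hq)), geom_sum_mul_neg]

theorem tendsto_qGamma (k : ℕ) :
    Filter.Tendsto (fun q : ℝ => qGamma q (k + 1)) (𝓝[≠] 1) (𝓝 (Real.Gamma ((k : ℝ) + 1))) := by
  have h := tendsto_finsetProd (Finset.range k) fun i _ => tendsto_qNum (i + 1)
  have e : ∏ i ∈ Finset.range k, (((i + 1 : ℕ) : ℝ)) = Real.Gamma ((k : ℝ) + 1) := by
    rw [Real.Gamma_nat_eq_factorial, ← Finset.prod_range_add_one_eq_factorial]
    push_cast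
    rfl
  rw [e] at h
  refine h.congr fun q => ?_
  rw [Finset.prod_div_distrib, qGamma_succ, qPoch, prod_Icc_one_eq_prod_range]
  simp

theorem gamma_succ_ne_zero (k : ℕ) : Real.Gamma ((k : ℝ) + 1) ≠ 0 :=
  (Real.Gamma_pos_of_pos (by positivity)).ne'

theorem barnesG_succ_ne_zero (k : ℕ) : barnesG (k + 1) ≠ 0 :=
  Finset.prod_ne_zero_iff.2 fun i _ => gamma_succ_ne_zero i

theorem tendsto_qBarnes (k : ℕ) :
    Filter.Tendsto (fun q : ℝ => qBarnes q (k + 1)) (𝓝[≠] 1) (𝓝 (barnesG (k + 1))) :=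
  tendsto_finsetProd _ fun i _ => tendsto_qGamma i

theorem choose_add_sub_one (c m : ℕ) :
    Ring.choose ((c : ℝ) + m - 1) m =
      (∏ i ∈ Finset.range m, (((c + i : ℕ) : ℝ))) / Real.Gamma ((m : ℝ) + 1) := by
  rw [eq_div_iff (gamma_succ_ne_zero m), ← Ring.multichoose_eq, Real.Gamma_nat_eq_factorial,
    mul_comm, ← nsmul_eq_mul, Ring.factorial_nsmul_multichoose_eq_ascPochhammer,
    Polynomial.ascPochhammer_smeval_eq_eval]
  induction m with
  | zero => simp
  | succ m ih => rw [ascPochhammer_succ_eval, ih, Finset.prod_range_succ, Nat.cast_add c m]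

/-- The limit is `Ring.choose` over ℝ because the binomials of `classicalFormula` elaborate there,
with cast arguments. The case c = 0 is included. -/
theorem tendsto_qBinom (c m : ℕ) :
    Filter.Tendsto (fun q : ℝ => qBinom q ((c : ℤ) + m - 1) m) (𝓝[≠] 1)
      (𝓝 (Ring.choose ((c : ℝ) + m - 1) m)) := by
  rw [choose_add_sub_one]
  have h := (tendsto_finsetProd (Finset.range m) fun i _ => tendsto_qNum (c + i)).div
    (tendsto_qGamma m) (gamma_succ_ne_zero m)
  refine h.congr' ?_
  filter_upwards [self_mem_nhdsWithin] with q hq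
  have h1 : (1 - q) ^ m ≠ 0 := pow_ne_zero _ (sub_ne_zero.2 (Ne.symm hq))
  rw [qBinom_sub_one, Pi.div_apply, Finset.prod_div_distrib, Finset.prod_const, Finset.card_range,
    qGamma_succ, div_div_div_cancel_right₀ h1]

theorem tendsto_qFormula {N d j k M : ℕ} (hM : d ≤ M) :
    Filter.Tendsto (fun q : ℝ => qFormula q N d j k M) (𝓝[≠] 1)
      (𝓝 (classicalFormula N d j k M)) := by
  have hz : ∀ z : ℤ, Filter.Tendsto (fun q : ℝ => q ^ z) (𝓝[≠] 1) (𝓝 1) := by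
    intro z
    have := (continuousAt_zpow₀ (1 : ℝ) z (Or.inl one_ne_zero)).tendsto.mono_left
      (nhdsWithin_le_nhds (s := {1}ᶜ))
    simpa using this
  have hterm : ∀ r ∈ Finset.Icc (max j k) N, Filter.Tendsto (fun q : ℝ => q ^ r
      * ((qGamma q (M - d + j + 1) * qGamma q (d + k + 1) * qGamma q (r + 1))
        / (qGamma q (j + 1) * qGamma q (k + 1) * qGamma q (M + r + 1)))
      * qBinom q ((M : ℤ) - d + r - k - 1) (r - k)
      * qBinom q ((d : ℤ) + r - j - 1) (r - j)) (𝓝[≠] 1)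
      (𝓝 (1 * ((Real.Gamma ((M : ℝ) - d + j + 1) * Real.Gamma ((d : ℝ) + k + 1) *
        Real.Gamma ((r : ℝ) + 1)) / (Real.Gamma ((j : ℝ) + 1) * Real.Gamma ((k : ℝ) + 1) *
          Real.Gamma ((M : ℝ) + r + 1)))
        * Ring.choose (((M : ℤ) : ℝ) - d + r - k - 1) (r - k)
        * Ring.choose (((d : ℤ) : ℝ) + r - j - 1) (r - j))) := by
    intro r hr
    have hr' := Finset.mem_Icc.1 hr
    have hjr : j ≤ r := le_trans (le_max_left _ _) hr'.1
    have hkr : k ≤ r := le_trans (le_max_right _ _) hr'.1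
    have g1 := tendsto_qGamma (M - d + j)
    have g2 := tendsto_qGamma (d + k)
    have g3 := tendsto_qGamma (M + r)
    have b1 := tendsto_qBinom (M - d) (r - k)
    have b2 := tendsto_qBinom d (r - j)
    have z1 := gamma_succ_ne_zero (M + r)
    push_cast [hM, hjr, hkr] at g1 g2 g3 b1 b2 z1
    rw [← add_sub_assoc] at b1 b2
    rw [← add_sub_assoc] at b1 b2
    push_cast
    refine ((Filter.Tendsto.mul ?_ (((g1.mul g2).mul (tendsto_qGamma r)).div
      (((tendsto_qGamma j).mul (tendsto_qGamma k)).mul g3) (mul_ne_zero (mul_ne_zero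
        (gamma_succ_ne_zero j) (gamma_succ_ne_zero k)) z1))).mul b1).mul b2
    simpa using hz r
  have hB := tendsto_qBarnes
  have hB0 := barnesG_succ_ne_zero
  have h := ((hz (((d : ℤ) - 1) * j - d * k + (d : ℤ) * ((d : ℤ) - 1) * N / 2)).mul
    ((((hB (N + 1)).mul ((hB (M + N + 1)).div (hB M) (hB0 M))).mul
      ((hB (M - d)).div (hB (M - d + N + 1)) (hB0 (M - d + N + 1)))).mul
        ((hB d).div (hB (d + N + 1)) (hB0 (d + N + 1))))).mul (tendsto_finsetSum _ hterm)
  have e : classicalFormula N d j k M = 1 * (barnesG (N + 2)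
      * (barnesG (M + N + 2) / barnesG (M + 1))
      * (barnesG (M - d + 1) / barnesG (M - d + N + 2))
      * (barnesG (d + 1) / barnesG (d + N + 2))) *
      ∑ r ∈ Finset.Icc (max j k) N,
        (1 * ((Real.Gamma ((M : ℝ) - d + j + 1) * Real.Gamma ((d : ℝ) + k + 1) *
        Real.Gamma ((r : ℝ) + 1)) / (Real.Gamma ((j : ℝ) + 1) * Real.Gamma ((k : ℝ) + 1) *
          Real.Gamma ((M : ℝ) + r + 1)))
        * Ring.choose (((M : ℤ) : ℝ) - d + r - k - 1) (r - k)
        * Ring.choose (((d : ℤ) : ℝ) + r - j - 1) (r - j)) := by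
    rw [classicalFormula, one_mul, mul_assoc, mul_assoc]
    congr 1
    rw [Finset.mul_sum, Finset.mul_sum]
    exact Finset.sum_congr rfl fun r _ => by ring
  rw [e]
  exact h

theorem continuous_skewSpec (N d j k M : ℕ) : Continuous fun q : ℝ => skewSpec q N d j k M := by
  simp only [skewSpec, MvPolynomial.eval_eq]
  fun_prop

/-- The specialization is a polynomial in q, hence continuous, and agrees with `qFormula` for
positive q ≠ 1; limits are unique. -/
theorem skewSpec_one {N d j k M : ℕ} (hd : 1 ≤ d) (hj : j ≤ N) (hk : k ≤ N) (hM : d ≤ M) :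
    skewSpec 1 N d j k M = classicalFormula N d j k M := by
  have h1 := ((continuous_skewSpec N d j k M).tendsto 1).mono_left
    (nhdsWithin_le_nhds (s := {1}ᶜ))
  refine tendsto_nhds_unique (h1.congr' ?_) (tendsto_qFormula hM)
  have hpos : ∀ᶠ q : ℝ in 𝓝[≠] 1, 0 < q :=
    nhdsWithin_le_nhds (Ioi_mem_nhds one_pos)
  filter_upwards [self_mem_nhdsWithin, hpos] with q hq hq0
  exact skewSpec_eq_qFormula hq0.ne' (by rwa [abs_of_pos hq0]) hd hj hk hM

end

theorem mainTheorem8 :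
    -- the explicit value of the principal specialization
    (∀ (q : ℝ), q ≠ 0 → |q| ≠ 1 →
      ∀ (N d j k M : ℕ), 1 ≤ d → j ≤ N → k ≤ N → (d < M ∨ (d ≤ M ∧ j = 0)) →
        skewSpec q N d j k M = qFormula q N d j k M) ∧
    -- its limit as `q → 1` is the explicit value at `(1, …, 1)`
    (∀ (N d j k M : ℕ), 1 ≤ d → j ≤ N → k ≤ N → (d < M ∨ (d ≤ M ∧ j = 0)) →
        Filter.Tendsto (fun q : ℝ => qFormula q N d j k M) (𝓝[≠] 1)
          (𝓝 (classicalFormula N d j k M)) ∧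
        skewSpec 1 N d j k M = classicalFormula N d j k M) ∧
    -- the symbol: Laurent expansion, Toeplitz determinants, biorthogonal polynomials, inverses
    (∀ (q : ℝ), q ≠ 0 → |q| ≠ 1 → ∀ (γ δ : ℕ), 1 ≤ γ → 1 ≤ δ →
      (∀ z : ℂ, z ≠ 0 → thetaSymbol q γ δ z =
        ∑ m ∈ Finset.Icc (-(δ : ℤ)) (γ : ℤ),
          ((qBinom q ((δ : ℤ) + γ) ((δ : ℤ) + m).toNat * q ^ (m * (m + 1) / 2) : ℝ) : ℂ)
            * z ^ m) ∧
      (∀ N : ℕ, (toeplitz (thetaSymbol q γ δ) N).det =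
        ((qBarnes q (N + 1)
          * (qBarnes q (δ + γ + N + 1) / qBarnes q (δ + γ + 1))
          * (qBarnes q (δ + 1) / qBarnes q (δ + N + 1))
          * (qBarnes q (γ + 1) / qBarnes q (γ + N + 1)) : ℝ) : ℂ)) ∧
      (∀ n : ℕ, (biorthP q γ δ n).natDegree = n ∧ (biorthQ q γ δ n).natDegree = n) ∧
      (∀ m n : ℕ,
        circleMean (fun z => (biorthP q γ δ m).eval z * (biorthQ q γ δ n).eval z⁻¹
          * thetaSymbol q γ δ z) = if m = n then 1 else 0) ∧
      (∀ N : ℕ, IsUnit (toeplitz (thetaSymbol q γ δ) (N + 1)).det ∧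
        ∀ a b : Fin (N + 1), (toeplitz (thetaSymbol q γ δ) (N + 1))⁻¹ a b =
          ((∑ r ∈ Finset.Icc (max (a : ℕ) (b : ℕ)) N,
            (-1) ^ ((a : ℕ) + (b : ℕ)) * q ^ (r - (b : ℕ))
            * ((qGamma q (γ + a + 1) * qGamma q (δ + b + 1) * qGamma q (r + 1))
              / (qGamma q ((a : ℕ) + 1) * qGamma q ((b : ℕ) + 1) * qGamma q (δ + γ + r + 1)))
            * qBinom q ((γ : ℤ) + r - (b : ℕ) - 1) (r - (b : ℕ))
            * qBinom q ((δ : ℤ) + r - (a : ℕ) - 1) (r - (a : ℕ)) : ℝ) : ℂ))) := by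
  refine ⟨?_, ?_, ?_⟩
  · intro q hq0 hq N d j k M hd hj hk hM
    exact skewSpec_eq_qFormula hq0 hq hd hj hk (by omega)
  · intro N d j k M hd hj hk hM
    exact ⟨tendsto_qFormula (by omega), skewSpec_one hd hj hk (by omega)⟩
  · intro q hq0 hq γ δ hγ hδ
    refine ⟨fun z hz => ?_, fun N => ?_, fun n => ?_, fun m n => ?_, fun N => ⟨?_, fun a b => ?_⟩⟩
    · rw [thetaSymbol_eq_sum hq0 hq γ δ hz]
      exact Finset.sum_congr rfl fun m hm => by rw [thetaCoeff_eq_qBinom hq hm]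
    · rw [det_toeplitz hq0 hq, det_thetaToeplitz hq0 hq]
    · obtain ⟨γ, rfl⟩ := Nat.exists_eq_add_of_le' hγ
      obtain ⟨δ, rfl⟩ := Nat.exists_eq_add_of_le' hδ
      exact ⟨natDegree_biorthP hq _ _ _, natDegree_biorthQ hq _ _ _⟩
    · obtain ⟨γ, rfl⟩ := Nat.exists_eq_add_of_le' hγ
      obtain ⟨δ, rfl⟩ := Nat.exists_eq_add_of_le' hδ
      exact circleMean_biorth hq0 hq γ δ m n
    · rw [det_toeplitz hq0 hq]
      exact (Complex.ofReal_ne_zero.2 (det_thetaToeplitz_ne_zero hq0 hq _ _ _)).isUnit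
    · exact toeplitz_inv hq0 hq γ δ N a b
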